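/- Fix an integer $n\ge 0$. For real polynomials $P(x)=\sum_{i=0}^n\binom ni a_ix^i$ and $Q(x)=\sum_{i=0}^n\binom ni b_ix^i$ let $P*Q(x)=\sum_{i=0}^n\binom ni a_ib_ix^i$ be their Schur–Szegő composition. Let $\mathrm{Hyp}_n^-$ be the set of real polynomials of degree exactly $n$ all of whose complex roots are real and negative. The multiplicity vector $MV_P$ of $P\in \mathrm{Hyp}_n^-$ is the ordered partition of $n$ formed by the multiplicities of the distinct roots of $P$, listed in increasing order of the roots. Then $P*Q\in\mathrm{Hyp}_n^-$ for all $P,Q\in\mathrm{Hyp}_n^-$; every ordered partition of $n$ is $MV_P$ for some $P\in\mathrm{Hyp}_n^-$; and there is exactly one semigroup structure $\ast$ on the set of all ordered partitions of $n$ such that $MV_{P*Q}=MV_P\ast MV_Q$ for all $P,Q\in\mathrm{Hyp}_n^-$. Moreover, for ordered partitions $p=(p_1,\dots,p_k)$ and $q=(q_1,\dots,q_l)$ of $n$, the product $p\ast q$ is the unique ordered partition $r$ of $n$ with the following two properties. (i) For all $i,j$ with $p_i+q_j>n$ there is an index $m$ such that $r_m=p_i+q_j-n$ and $r_1+\dots+r_{m-1}=(p_1+\dots+p_{i-1})+(q_1+\dots+q_{j-1})$.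 (ii) Every part $r_m$ that does not arise from such a pair $(i,j)$ as in (i) equals $1$. For example, for $n=17$, $(2,14,1)\ast(5,6,6)=(1,1,2,1,1,1,3,1,1,1,3,1)$ and $(1,14,2)\ast(5,6,4,2)=(1,2,1,1,1,3,1,1,1,1,1,1,1,1)$. -/

import Mathlib

open Polynomial

/-- The diagonal sequence of a polynomial of degree at most `n`: the numbers `a i` with
`P = ∑ i ≤ n, (n choose i) * a i * x ^ i`. -/
noncomputable def diagSeq (n : ℕ) (P : ℝ[X]) (i : ℕ) : ℝ :=
  P.coeff i / (n.choose i : ℝ)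

/-- The Schur–Szegő composition `P ∗ Q = ∑ i ≤ n, (n choose i) * a i * b i * x ^ i`, where `a`, `b`
are the diagonal sequences of `P`, `Q`. -/
noncomputable def schurSzego (n : ℕ) (P Q : ℝ[X]) : ℝ[X] :=
  ∑ i ∈ Finset.range (n + 1),
    C ((n.choose i : ℝ) * (diagSeq n P i * diagSeq n Q i)) * X ^ i

/-- `P ∈ Hyp_n`: a real polynomial of degree exactly `n` (so that it has `n` roots with
multiplicity), all of whose complex roots are real. -/
def IsHyp (n : ℕ) (P : ℝ[X]) : Prop :=
  P.degree = (n : WithBot ℕ) ∧ P.Splits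

/-- `P ∈ Hyp_n^-`: all roots are real and negative. -/
def IsHypNeg (n : ℕ) (P : ℝ[X]) : Prop :=
  IsHyp n P ∧ ∀ x : ℝ, P.IsRoot x → x < 0

/-- The multiplicities of the distinct roots of `P`, listed in increasing order of the roots. -/
noncomputable def multList (P : ℝ[X]) : List ℕ :=
  (P.roots.toFinset.sort (· ≤ ·)).map (fun x => P.rootMultiplicity x)

theorem multList_pos (P : ℝ[X]) {k : ℕ} (hk : k ∈ multList P) : 0 < k := by
  classical
  simp only [multList, List.mem_map, Finset.mem_sort, Multiset.mem_toFinset] at hk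
  obtain ⟨x, hx, rfl⟩ := hk
  rw [← Polynomial.count_roots]
  exact Multiset.count_pos.2 hx

theorem multList_sum {n : ℕ} {P : ℝ[X]} (hP : IsHyp n P) : (multList P).sum = n := by
  classical
  have h1 : (multList P).sum = ∑ x ∈ P.roots.toFinset, P.roots.count x := by
    simp only [multList, Polynomial.count_roots]
    rw [← Finset.sum_map_toList P.roots.toFinset]
    exact (List.Perm.map _ (Finset.sort_perm_toList P.roots.toFinset (· ≤ ·))).sum_eq
  rw [h1, Multiset.toFinset_sum_count_eq, ← hP.2.natDegree_eq_card_roots]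
  exact Polynomial.natDegree_eq_of_degree_eq_some hP.1

/-- The multiplicity vector `MV_P` of `P ∈ Hyp_n`, an ordered partition (composition) of `n`. -/
noncomputable def multVector (n : ℕ) (P : ℝ[X]) (hP : IsHyp n P) : Composition n where
  blocks := multList P
  blocks_pos := fun hk => multList_pos P hk
  blocks_sum := multList_sum hP

/-- The semigroup structure `S` on the ordered partitions of `n` is induced by the Schur–Szegő
composition on `Hyp_n^-`: that set is closed under `∗` and `MV_{P ∗ Q}` is the product of
`MV_P` and `MV_Q`. -/
def IsInducedSemigroup (n : ℕ) (S : Semigroup (Composition n)) : Prop :=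
  ∀ (P Q : ℝ[X]) (hP : IsHypNeg n P) (hQ : IsHypNeg n Q),
    ∃ hPQ : IsHypNeg n (schurSzego n P Q),
      multVector n (schurSzego n P Q) hPQ.1 =
        S.mul (multVector n P hP.1) (multVector n Q hQ.1)

/-- The block `i` of `p` and the block `j` of `q` form a pair of A-blocks: their sizes add up
to more than `n`. -/
def IsAPair {n : ℕ} (p q : Composition n) (i : Fin p.length) (j : Fin q.length) : Prop :=
  n < p.blocksFun i + q.blocksFun j

/-- The rules for the composed partition `r` of `p` and `q`.
Each pair of A-blocks `i`, `j` yields a block of `r` of size `p_i + q_j - n`, and the total size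
of the blocks of `r` before it is the sum of the total sizes of the blocks before `i` in `p` and
before `j` in `q`. All other blocks of `r` have size `1`. (A block is determined by the total
size of the blocks before it.) -/
def IsComposedPartition {n : ℕ} (p q r : Composition n) : Prop :=
  (∀ (i : Fin p.length) (j : Fin q.length), IsAPair p q i j →
    ∃ k : Fin r.length,
      r.blocksFun k = p.blocksFun i + q.blocksFun j - n ∧
      r.sizeUpTo k = p.sizeUpTo i + q.sizeUpTo j) ∧
  (∀ k : Fin r.length,
    (¬ ∃ (i : Fin p.length) (j : Fin q.length), IsAPair p q i j ∧
      r.sizeUpTo k = p.sizeUpTo i + q.sizeUpTo j) →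
    r.blocksFun k = 1)

/-! ### The composition over a general field -/

section Field

variable {K : Type*} [Field K]

/-! Up to a nonzero constant, the value of P∗Q at x is an iterated polar derivative of Q. Removing a
factor X + a with a ≠ 0 from P replaces Q by its polar derivative with pole x/a
(`succ_mul_eval_szComp`). Statements about P∗Q thus become statements about polar derivatives,
proved by induction over the factors of P.

Closure follows from Laguerre's theorem for half-planes (`eval_polarDeriv_ne_zero_of_halfPlane`).
For multiplicities, suppose a and b are roots of P and Q whose multiplicities add up to more than n.
Then -ab is a root of P∗Q, and passing to derivatives shows that its multiplicity is at least the
excess over n (`rootMultiplicity_add_le`).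

Conversely, every multiple root of P∗Q arises in this way (`exists_rootMultiplicity_add_eq`).
Polarizing a real-rooted Q in all but two arguments gives a real-rooted quadratic. Its discriminant
yields a Rayleigh inequality, and summing over the roots of P yields a Wronskian inequality
(`sq_le_wronskian`). At a double root this makes every polarization with one argument missing
vanish, and equality in a variance estimate then traces the root back to roots of P and Q of large
multiplicity.

For the position of -ab, the Wronskian inequality gives interlacing. On each side of -ab, P∗Q
therefore has at most as many roots as P beside a and Q beside b together (`sideCount_szComp_le`).
Since all roots number n, these bounds and the bound on the multiplicity must all be equalities
(`rootsBelow_szComp`).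

So MV of P∗Q obeys rules that involve only MV of P and MV of Q, and these rules determine a
composition. Every composition is realized by a polynomial, so the product is well defined and
unique, and it inherits associativity from the coefficientwise formula. -/

/-- The Schur–Szegő composition of formal degree `n` over a field. -/
noncomputable def szComp (n : ℕ) (P Q : K[X]) : K[X] :=
  ∑ i ∈ Finset.range (n + 1), C (P.coeff i * Q.coeff i / (n.choose i : K)) * X ^ i

/-- The polar derivative with pole `y` of a polynomial of formal degree `n`. -/
noncomputable def polarDeriv (n : ℕ) (y : K) (Q : K[X]) : K[X] :=
  C (n : K) * Q - (X - C y) * derivative Q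

/-- The monic polynomial with roots `-a`, `a ∈ s`. -/
noncomputable def shiftProd (s : Multiset K) : K[X] :=
  (s.map fun a => X + C a).prod

theorem coeff_szComp (n : ℕ) (P Q : K[X]) (i : ℕ) :
    (szComp n P Q).coeff i = P.coeff i * Q.coeff i / (n.choose i : K) := by
  simp only [szComp, finsetSum_coeff, coeff_C_mul, coeff_X_pow, mul_ite, mul_one, mul_zero]
  rw [Finset.sum_ite_eq]
  split_ifs with h
  · rfl
  -- Beyond `n` the binomial coefficient is zero and division by zero returns zero, so the formula
  -- needs no degree bound.
  · rw [Nat.choose_eq_zero_of_lt (by simpa using h)]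
    simp

theorem szComp_comm (n : ℕ) (P Q : K[X]) : szComp n P Q = szComp n Q P := by
  ext i
  simp only [coeff_szComp, mul_comm]

theorem szComp_add (n : ℕ) (P Q R : K[X]) :
    szComp n P (Q + R) = szComp n P Q + szComp n P R := by
  ext i
  simp only [coeff_szComp, coeff_add]
  ring

theorem szComp_C_mul (n : ℕ) (c : K) (P Q : K[X]) :
    szComp n P (C c * Q) = C c * szComp n P Q := by
  ext i
  simp only [coeff_szComp, coeff_C_mul]
  ring

theorem C_mul_szComp (n : ℕ) (c : K) (P Q : K[X]) :
    szComp n (C c * P) Q = C c * szComp n P Q := by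
  rw [szComp_comm, szComp_C_mul, szComp_comm]

theorem add_szComp (n : ℕ) (P Q R : K[X]) :
    szComp n (P + Q) R = szComp n P R + szComp n Q R := by
  rw [szComp_comm, szComp_add, szComp_comm n R P, szComp_comm n R Q]

theorem szComp_zero (n : ℕ) (P : K[X]) : szComp n P 0 = 0 := by
  ext i
  simp [coeff_szComp]

theorem zero_szComp (n : ℕ) (P : K[X]) : szComp n 0 P = 0 := by
  rw [szComp_comm, szComp_zero]

theorem sum_szComp (n : ℕ) (s : Multiset K[X]) (Q : K[X]) :
    szComp n s.sum Q = (s.map fun P => szComp n P Q).sum := by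
  induction s using Multiset.induction_on with
  | empty => simp [zero_szComp]
  | cons a s ih => simp [add_szComp, ih]

theorem szComp_assoc (n : ℕ) (P Q R : K[X]) :
    szComp n (szComp n P Q) R = szComp n P (szComp n Q R) := by
  ext i
  simp only [coeff_szComp]
  ring

theorem map_szComp {L : Type*} [Field L] (f : K →+* L) (n : ℕ) (P Q : K[X]) :
    (szComp n P Q).map f = szComp n (P.map f) (Q.map f) := by
  ext i
  simp [coeff_szComp, coeff_map]

theorem coeff_polarDeriv_zero (n : ℕ) (Q : K[X]) (i : ℕ) :
    (polarDeriv n 0 Q).coeff i = ((n : K) - i) * Q.coeff i := by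
  cases i with
  | zero => simp [polarDeriv]
  | succ i =>
    simp [polarDeriv, coeff_derivative, coeff_X_mul]
    ring

theorem polarDeriv_eq (n : ℕ) (y : K) (Q : K[X]) :
    polarDeriv n y Q = polarDeriv n 0 Q + C y * derivative Q := by
  simp only [polarDeriv, C_0]
  ring

/-- The polarization of `Q` is symmetric in its poles. This lets a pole be moved past the pole 0 in
the inductions below. -/
theorem polarDeriv_comm (n : ℕ) (y z : K) (Q : K[X]) :
    polarDeriv n y (polarDeriv (n + 1) z Q) = polarDeriv n z (polarDeriv (n + 1) y Q) := by
  simp only [polarDeriv, derivative_sub, derivative_mul, derivative_C, derivative_X]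
  push_cast
  simp only [C_add, C_1]
  ring

theorem derivative_polarDeriv (n : ℕ) (y : K) (Q : K[X]) :
    derivative (polarDeriv (n + 1) y Q) = polarDeriv n y (derivative Q) := by
  simp only [polarDeriv, derivative_sub, derivative_mul, derivative_C, derivative_X]
  push_cast
  simp only [C_add, C_1]
  ring

theorem natDegree_polarDeriv_le {n : ℕ} {Q : K[X]} (hQ : Q.natDegree ≤ n + 1) (y : K) :
    (polarDeriv (n + 1) y Q).natDegree ≤ n := by
  rw [polarDeriv_eq]
  refine natDegree_add_le_of_degree_le ?_ ?_
  · rw [natDegree_le_iff_coeff_eq_zero]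
    intro N hN
    rw [coeff_polarDeriv_zero]
    rcases (Nat.succ_le_of_lt hN).eq_or_lt with h | h
    · subst h; simp
    · rw [coeff_eq_zero_of_natDegree_lt (hQ.trans_lt h), mul_zero]
  · exact (natDegree_C_mul_le _ _).trans ((natDegree_derivative_le _).trans (by omega))

@[simp] theorem shiftProd_zero : shiftProd (0 : Multiset K) = 1 := by simp [shiftProd]

@[simp] theorem shiftProd_cons (a : K) (s : Multiset K) :
    shiftProd (a ::ₘ s) = (X + C a) * shiftProd s := by simp [shiftProd]

theorem shiftProd_monic (s : Multiset K) : (shiftProd s).Monic :=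
  monic_multiset_prod_of_monic _ _ fun a _ => monic_X_add_C a

theorem natDegree_shiftProd (s : Multiset K) : (shiftProd s).natDegree = s.card := by
  rw [shiftProd, natDegree_multiset_prod_of_monic]
  · simp
  · simp only [Multiset.mem_map]
    rintro _ ⟨a, -, rfl⟩
    exact monic_X_add_C a

theorem shiftProd_ne_zero (s : Multiset K) : shiftProd s ≠ 0 := (shiftProd_monic s).ne_zero

theorem roots_shiftProd (s : Multiset K) : (shiftProd s).roots = s.map (fun a => -a) := by
  have := roots_multiset_prod_X_sub_C (s.map fun a => -a)
  rw [Multiset.map_map] at this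
  rw [← this, shiftProd]
  simp

theorem rootMultiplicity_shiftProd [DecidableEq K] (s : Multiset K) (a : K) :
    (shiftProd s).rootMultiplicity (-a) = s.count a := by
  rw [← count_roots, roots_shiftProd, Multiset.count_map_eq_count' _ _ neg_injective]

theorem splits_shiftProd (s : Multiset K) : (shiftProd s).Splits :=
  Splits.multisetProd (by
    simp only [Multiset.mem_map]
    rintro _ ⟨a, -, rfl⟩
    exact Splits.X_add_C a)

theorem eq_C_mul_shiftProd {P : K[X]} (hP : P.Splits) :
    P = C P.leadingCoeff * shiftProd (P.roots.map fun a => -a) := by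
  conv_lhs => rw [hP.eq_prod_roots]
  simp [shiftProd, Multiset.map_map, sub_eq_add_neg]

theorem map_shiftProd {L : Type*} [Field L] (f : K →+* L) (s : Multiset K) :
    (shiftProd s).map f = shiftProd (s.map f) := by
  simp [shiftProd, Polynomial.map_multiset_prod, Multiset.map_map]

theorem derivative_shiftProd [DecidableEq K] (s : Multiset K) :
    derivative (shiftProd s) = (s.map fun a => shiftProd (s.erase a)).sum := by
  rw [shiftProd, derivative_prod]
  simp [shiftProd]

variable [CharZero K]

/-- Coefficientwise this is the absorption identity for binomial coefficients together with Pascal's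
rule. -/
theorem succ_mul_szComp_X_add_C_mul {n : ℕ} {P : K[X]} (hP : P.natDegree ≤ n) (a : K) (Q : K[X]) :
    C ((n : K) + 1) * szComp (n + 1) ((X + C a) * P) Q =
      X * szComp n P (derivative Q) + C a * szComp n P (polarDeriv (n + 1) 0 Q) := by
  ext i
  rw [add_mul]
  cases i with
  | zero =>
    simp [coeff_szComp, coeff_polarDeriv_zero]
    ring
  | succ i =>
    simp only [coeff_C_mul, coeff_add, coeff_szComp, coeff_X_mul, coeff_polarDeriv_zero,
      coeff_derivative]
    rcases lt_trichotomy i n with h | h | h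
    · have h1 : ((n.choose i : ℕ) : K) ≠ 0 := by exact_mod_cast (Nat.choose_pos h.le).ne'
      have h2 : ((n.choose (i + 1) : ℕ) : K) ≠ 0 := by exact_mod_cast (Nat.choose_pos h).ne'
      have h3 : (((n + 1).choose (i + 1) : ℕ) : K) ≠ 0 := by
        exact_mod_cast (Nat.choose_pos (by omega)).ne'
      have e1 : ((n : K) + 1) * (n.choose i : K) = ((n + 1).choose (i + 1) : K) * (i + 1) := by
        exact_mod_cast Nat.add_one_mul_choose_eq n i
      have e2 : ((n + 1).choose (i + 1) : K) = n.choose i + n.choose (i + 1) := by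
        exact_mod_cast Nat.choose_succ_succ n i
      rw [show ∀ u : K, ((n : K) + 1) * ((P.coeff i + a * P.coeff (i + 1)) * Q.coeff (i + 1) / u) =
        (n + 1) * (P.coeff i * Q.coeff (i + 1)) / u +
          (n + 1) * (a * (P.coeff (i + 1) * Q.coeff (i + 1))) / u by intro u; ring]
      congr 1
      · rw [div_eq_div_iff h3 h1]
        linear_combination P.coeff i * Q.coeff (i + 1) * e1
      · rw [← mul_div_assoc, div_eq_div_iff h3 h2]
        push_cast
        linear_combination (- a * P.coeff (i + 1) * Q.coeff (i + 1)) * e1 +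
           (- a * P.coeff (i + 1) * Q.coeff (i + 1)) * (n + 1) * e2
    · subst h
      rw [coeff_eq_zero_of_natDegree_lt (Nat.lt_succ_of_le hP)]
      simp
      ring
    · rw [Nat.choose_eq_zero_of_lt h, Nat.choose_eq_zero_of_lt (show n < i + 1 by omega),
        Nat.choose_eq_zero_of_lt (show n + 1 < i + 1 by omega)]
      simp

/-- The engine of all the inductions: at the point `x` the two terms of the recursion merge into a
single polar derivative, with pole `x / a`. -/
theorem succ_mul_eval_szComp {n : ℕ} {P : K[X]} (hP : P.natDegree ≤ n) {a : K} (ha : a ≠ 0)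
    (Q : K[X]) (x : K) :
    ((n : K) + 1) * (szComp (n + 1) ((X + C a) * P) Q).eval x =
      a * (szComp n P (polarDeriv (n + 1) (x / a) Q)).eval x := by
  have := congr_arg (eval x) (succ_mul_szComp_X_add_C_mul hP a Q)
  simp only [eval_mul, eval_add, eval_C, eval_X] at this
  rw [this, polarDeriv_eq _ (x / a), szComp_add, szComp_C_mul]
  simp only [eval_mul, eval_add, eval_C]
  field_simp
  ring

theorem succ_mul_derivative_szComp (n : ℕ) (P Q : K[X]) :
    C ((n : K) + 1) * derivative (szComp (n + 1) P Q) =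
      szComp n (derivative P) (derivative Q) := by
  ext i
  simp only [coeff_C_mul, coeff_szComp, coeff_derivative]
  rcases le_or_gt i n with h | h
  · have h1 : ((n.choose i : ℕ) : K) ≠ 0 := by exact_mod_cast (Nat.choose_pos h).ne'
    have h3 : (((n + 1).choose (i + 1) : ℕ) : K) ≠ 0 := by
      exact_mod_cast (Nat.choose_pos (by omega)).ne'
    have e1 : ((n : K) + 1) * (n.choose i : K) = ((n + 1).choose (i + 1) : K) * (i + 1) := by
      exact_mod_cast Nat.add_one_mul_choose_eq n i
    field_simp
    linear_combination P.coeff (i + 1) * Q.coeff (i + 1) * e1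
  · rw [Nat.choose_eq_zero_of_lt h, Nat.choose_eq_zero_of_lt (show n + 1 < i + 1 by omega)]
    simp

theorem szComp_X_add_one_pow {n : ℕ} {Q : K[X]} (hQ : Q.natDegree ≤ n) :
    szComp n ((X + 1) ^ n) Q = Q := by
  ext i
  rw [coeff_szComp, coeff_X_add_one_pow]
  rcases le_or_gt i n with h | h
  · have h1 : ((n.choose i : ℕ) : K) ≠ 0 := by exact_mod_cast (Nat.choose_pos h).ne'
    field_simp
  · rw [coeff_eq_zero_of_natDegree_lt (hQ.trans_lt h)]
    simp

end Field

theorem schurSzego_eq_szComp (n : ℕ) (P Q : ℝ[X]) : schurSzego n P Q = szComp n P Q := by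
  refine Finset.sum_congr rfl fun i hi => ?_
  have h1 : ((n.choose i : ℕ) : ℝ) ≠ 0 := by
    exact_mod_cast (Nat.choose_pos (by simpa [Nat.lt_succ_iff] using hi)).ne'
  rw [diagSeq, diagSeq]
  congr 2
  field_simp

/-! ### Laguerre's theorem for half-planes and closure under composition -/

theorem Multiset.map_sum_le_card_mul {M : Type*} [AddCommMonoid M] (g : M →+ ℝ) (s : Multiset M)
    {b : ℝ} (h : ∀ w ∈ s, g w ≤ b) : g s.sum ≤ s.card * b := by
  rw [map_multiset_sum, ← nsmul_eq_mul, ← Multiset.card_map g s]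
  refine Multiset.sum_le_card_nsmul _ _ ?_
  simpa using h

theorem Complex.re_mul_conj_one_div (u v : ℂ) :
    (u * (starRingEnd ℂ) (1 / v)).re = Complex.normSq (1 / v) * (u * v).re := by
  rcases eq_or_ne v 0 with rfl | hv
  · simp
  have : (starRingEnd ℂ) (1 / v) = (Complex.normSq (1 / v) : ℝ) * v := by
    rw [Complex.normSq_eq_conj_mul_self]
    field_simp
  rw [this, mul_left_comm, Complex.re_ofReal_mul]

theorem two_mul_re_conj_mul_le (a b : ℂ) :
    2 * ((starRingEnd ℂ) a * b).re ≤ Complex.normSq a + Complex.normSq b := by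
  have := Complex.normSq_nonneg (a - b)
  simp only [Complex.normSq_apply, Complex.sub_re, Complex.sub_im, Complex.mul_re,
    Complex.conj_re, Complex.conj_im] at *
  nlinarith

/-- Inversion about `z` sends the half-plane containing the points `w` into a disc, and `1 / (z -
y)` lies outside that disc. A mean of points of a disc stays in the disc. -/
theorem sum_one_div_ne_of_halfPlane {u z y : ℂ} {c : ℝ} (hz : (u * z).re < c)
    (hy : (u * y).re < c) (hzy : z ≠ y) (s : Multiset ℂ) (hs : ∀ w ∈ s, c ≤ (u * w).re)
    (h0 : s.card ≠ 0) : (s.map fun w => 1 / (z - w)).sum ≠ s.card * (1 / (z - y)) := by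
  intro h
  set τ := 1 / (z - y) with hτ
  set δ := c - (u * z).re with hδ
  have hδ0 : 0 < δ := by linarith
  have hτ0 : 0 < Complex.normSq τ := Complex.normSq_pos.2 (by
    rw [hτ]; exact one_div_ne_zero (sub_ne_zero.2 hzy))
  -- The disc is `Re (u * conj v) + δ * |v| ^ 2 ≤ 0`; `g` is the real-linear functional obtained by
  -- linearizing the quadratic term at `τ`, and it separates `τ` from the disc.
  let g : ℂ →+ ℝ := AddMonoidHom.mk'
    (fun w => (u * (starRingEnd ℂ) w).re + δ * (2 * ((starRingEnd ℂ) τ * w).re))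
    (by intro a b; simp only [map_add, mul_add, Complex.add_re]; ring)
  have key := Multiset.map_sum_le_card_mul g (s.map fun w => 1 / (z - w))
    (b := δ * Complex.normSq τ) (by
      intro v hv
      obtain ⟨w, hw, rfl⟩ := Multiset.mem_map.1 hv
      have h1 : (u * (z - w)).re ≤ -δ := by
        have := hs w hw
        rw [mul_sub, Complex.sub_re]; linarith
      have h2 := two_mul_re_conj_mul_le τ (1 / (z - w))
      have h3 := mul_le_mul_of_nonneg_left h1 (Complex.normSq_nonneg (1 / (z - w)))
      have h4 := mul_le_mul_of_nonneg_left h2 hδ0.le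
      simp only [g, AddMonoidHom.mk'_apply, Complex.re_mul_conj_one_div]
      linarith)
  have h5 : g (s.card * τ) = s.card * (Complex.normSq τ * (u * (z - y)).re +
      δ * (2 * Complex.normSq τ)) := by
    rw [← nsmul_eq_mul, map_nsmul, nsmul_eq_mul]
    congr 1
    simp only [g, AddMonoidHom.mk'_apply]
    rw [← Complex.normSq_eq_conj_mul_self, Complex.ofReal_re, hτ, Complex.re_mul_conj_one_div]
  rw [h, h5, Multiset.card_map] at key
  have hs0 : (0 : ℝ) < s.card := by exact_mod_cast Nat.pos_of_ne_zero h0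
  have h6 : -δ < (u * (z - y)).re := by
    rw [mul_sub, Complex.sub_re]; linarith
  have h7 := mul_lt_mul_of_pos_left h6 hτ0
  have := le_of_mul_le_mul_left key hs0
  linarith

theorem eval_polarDeriv_ne_zero_of_halfPlane {u y z : ℂ} {c : ℝ} {n : ℕ} {Q : ℂ[X]} (hQ : Q ≠ 0)
    (hn : Q.natDegree = n + 1) (hr : ∀ w ∈ Q.roots, c ≤ (u * w).re) (hy : (u * y).re < c)
    (hz : (u * z).re < c) : (polarDeriv (n + 1) y Q).eval z ≠ 0 := by
  intro h
  have hQs := IsAlgClosed.splits Q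
  have hQz : Q.eval z ≠ 0 := fun h0 => by
    have := hr z ((mem_roots hQ).2 h0)
    linarith
  have hcard : Q.roots.card = n + 1 := by rw [← hQs.natDegree_eq_card_roots, hn]
  simp only [polarDeriv, eval_sub, eval_mul, eval_C, eval_X] at h
  have hn0 : ((n + 1 : ℕ) : ℂ) ≠ 0 := by exact_mod_cast Nat.succ_ne_zero n
  have hzy : z ≠ y := by
    rintro rfl
    rw [sub_self, zero_mul, sub_zero] at h
    exact mul_ne_zero hn0 hQz h
  refine sum_one_div_ne_of_halfPlane hz hy hzy Q.roots hr (by omega) ?_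
  rw [← hQs.eval_derivative_div_eval_of_ne_zero hQz, hcard]
  have := sub_ne_zero.2 hzy
  field_simp
  linear_combination -h

/-- The coefficient in degree `n` is the leading coefficient of `Q` times `(n + 1) * y` minus the
sum of the roots; it is nonzero because the mean of the roots stays in their closed half-plane. -/
theorem natDegree_polarDeriv_of_halfPlane {u y : ℂ} {c : ℝ} {n : ℕ} {Q : ℂ[X]} (hQ : Q ≠ 0)
    (hn : Q.natDegree = n + 1) (hr : ∀ w ∈ Q.roots, c ≤ (u * w).re) (hy : (u * y).re < c) :
    (polarDeriv (n + 1) y Q).natDegree = n := by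
  refine le_antisymm (natDegree_polarDeriv_le hn.le y) (le_natDegree_of_ne_zero ?_)
  have hQs := IsAlgClosed.splits Q
  have hcard : Q.roots.card = n + 1 := by rw [← hQs.natDegree_eq_card_roots, hn]
  have h1 := hQs.nextCoeff_eq_neg_sum_roots_mul_leadingCoeff
  rw [nextCoeff_of_natDegree_pos (by omega), hn, Nat.add_sub_cancel] at h1
  have hlc : Q.coeff (n + 1) = Q.leadingCoeff := by rw [leadingCoeff, hn]
  rw [polarDeriv_eq, coeff_add, coeff_polarDeriv_zero, coeff_C_mul, coeff_derivative, hlc, h1]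
  have h2 : (((n + 1 : ℕ) : ℂ) - n) * (-Q.leadingCoeff * Q.roots.sum) +
      y * (Q.leadingCoeff * (n + 1)) = Q.leadingCoeff * ((n + 1) * y - Q.roots.sum) := by
    push_cast; ring
  rw [h2]
  refine mul_ne_zero (leadingCoeff_ne_zero.2 hQ) (sub_ne_zero.2 fun h => ?_)
  let g : ℂ →+ ℝ := AddMonoidHom.mk' (fun w => -(u * w).re)
    (by intro a b; simp only [mul_add, Complex.add_re]; ring)
  have key := Multiset.map_sum_le_card_mul g Q.roots (b := -c) (fun w hw => by
    have := hr w hw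
    simp only [g, AddMonoidHom.mk'_apply]
    linarith)
  have h3 : g ((n + 1) * y) = (n + 1) * -(u * y).re := by
    have : ((n + 1) * y : ℂ) = (n + 1) • y := by rw [nsmul_eq_mul]; push_cast; ring
    rw [this, map_nsmul, nsmul_eq_mul]
    simp [g]
  rw [← h, h3, hcard] at key
  push_cast at key
  have := le_of_mul_le_mul_left key (by positivity)
  linarith

theorem eval_szComp_shiftProd_ne_zero {u x : ℂ} {c : ℝ} (t : Multiset ℂ)
    (ht : ∀ a ∈ t, a ≠ 0 ∧ (u * (x / a)).re < c) {Q : ℂ[X]} (hQ : Q ≠ 0)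
    (hn : Q.natDegree = t.card) (hr : ∀ w ∈ Q.roots, c ≤ (u * w).re) :
    (szComp t.card (shiftProd t) Q).eval x ≠ 0 := by
  induction t using Multiset.induction_on generalizing Q with
  | empty =>
    rw [Multiset.card_zero] at hn ⊢
    rw [natDegree_eq_zero] at hn
    obtain ⟨q, rfl⟩ := hn
    have : q ≠ 0 := by rintro rfl; simp at hQ
    simpa [szComp] using this
  | cons a t ih =>
    have ha := ht a (by simp)
    rw [Multiset.card_cons] at hn ⊢
    rw [shiftProd_cons]
    have h := succ_mul_eval_szComp (natDegree_shiftProd t).le ha.1 Q x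
    have hev := fun z => @eval_polarDeriv_ne_zero_of_halfPlane u (x / a) z c _ Q hQ hn hr ha.2
    have h0 : polarDeriv (t.card + 1) (x / a) Q ≠ 0 := by
      intro h0
      exact hev _ ha.2 (by rw [h0, eval_zero])
    have := ih (fun b hb => ht b (by simp [hb])) h0
      (natDegree_polarDeriv_of_halfPlane hQ hn hr ha.2)
      (fun w hw => by
        by_contra hlt
        exact hev w (not_le.1 hlt) (isRoot_of_mem_roots hw))
    intro h'
    rw [h', mul_zero] at h
    exact mul_ne_zero ha.1 this h.symm

theorem eval_map_szComp_shiftProd_ne_zero {u x : ℂ} {c : ℝ} (s : Multiset ℝ)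
    (hs : ∀ a ∈ s, a ≠ 0 ∧ (u * (x / a)).re < c) {Q : ℝ[X]} (hQ : Q ≠ 0)
    (hn : Q.natDegree = s.card) (hsp : Q.Splits) (hr : ∀ r ∈ Q.roots, c ≤ (u * (r : ℂ)).re) :
    ((szComp s.card (shiftProd s) Q).map Complex.ofRealHom).eval x ≠ 0 := by
  rw [map_szComp, map_shiftProd]
  have := eval_szComp_shiftProd_ne_zero (u := u) (x := x) (c := c) (s.map Complex.ofRealHom)
    (by
      intro a ha
      obtain ⟨b, hb, rfl⟩ := Multiset.mem_map.1 ha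
      simpa using hs b hb)
    ((Polynomial.map_ne_zero_iff Complex.ofRealHom.injective).2 hQ)
    (by rw [natDegree_map, hn, Multiset.card_map])
    (by
      rw [hsp.roots_map]
      intro w hw
      obtain ⟨b, hb, rfl⟩ := Multiset.mem_map.1 hw
      exact hr b hb)
  rwa [Multiset.card_map] at this

theorem splits_of_forall_im_eq_zero {P : ℝ[X]}
    (h : ∀ z : ℂ, (P.map Complex.ofRealHom).eval z = 0 → z.im = 0) : P.Splits := by
  refine Splits.of_splits_map Complex.ofRealHom (IsAlgClosed.splits _) fun a ha => ?_
  exact ⟨a.re, Complex.ext (by simp) (by simp [h a (isRoot_of_mem_roots ha)])⟩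

namespace IsHypNeg

variable {n : ℕ} {P Q : ℝ[X]}

theorem ne_zero (hP : IsHypNeg n P) : P ≠ 0 := by
  rintro rfl
  simpa using hP.1.1

theorem splits (hP : IsHypNeg n P) : P.Splits := hP.1.2

theorem natDegree_eq (hP : IsHypNeg n P) : P.natDegree = n :=
  natDegree_eq_of_degree_eq_some hP.1.1

theorem neg_of_mem_roots (hP : IsHypNeg n P) {r : ℝ} (hr : r ∈ P.roots) : r < 0 :=
  hP.2 r (isRoot_of_mem_roots hr)

theorem card_roots (hP : IsHypNeg n P) : P.roots.card = n := by
  rw [← hP.splits.natDegree_eq_card_roots, hP.natDegree_eq]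

theorem of_natDegree (h0 : P ≠ 0) (hn : P.natDegree = n) (hs : P.Splits)
    (hr : ∀ r ∈ P.roots, r < 0) : IsHypNeg n P :=
  ⟨⟨by rw [degree_eq_natDegree h0, hn], hs⟩, fun x hx => hr x ((mem_roots h0).2 hx)⟩

theorem exists_eq_C_mul_shiftProd (hP : IsHypNeg n P) :
    ∃ (c : ℝ) (s : Multiset ℝ), c ≠ 0 ∧ s.card = n ∧ (∀ a ∈ s, 0 < a) ∧
      P = C c * shiftProd s := by
  refine ⟨P.leadingCoeff, P.roots.map fun a => -a, leadingCoeff_ne_zero.2 hP.ne_zero,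
    by rw [Multiset.card_map, hP.card_roots], ?_, eq_C_mul_shiftProd hP.splits⟩
  intro a ha
  obtain ⟨b, hb, rfl⟩ := Multiset.mem_map.1 ha
  exact neg_pos.2 (hP.neg_of_mem_roots hb)

theorem C_mul (hP : IsHypNeg n P) {c : ℝ} (hc : c ≠ 0) : IsHypNeg n (C c * P) :=
  of_natDegree (mul_ne_zero (by simpa using hc) hP.ne_zero)
    (by rw [natDegree_C_mul hc, hP.natDegree_eq]) (hP.splits.C_mul c)
    (by rw [roots_C_mul _ hc]; exact fun r => hP.neg_of_mem_roots)

theorem shiftProd {s : Multiset ℝ} (hs : ∀ a ∈ s, 0 < a) (hn : s.card = n) :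
    IsHypNeg n (shiftProd s) :=
  of_natDegree (shiftProd_ne_zero s) (by rw [natDegree_shiftProd, hn]) (splits_shiftProd s)
    (by
      rw [roots_shiftProd]
      intro r hr
      obtain ⟨a, ha, rfl⟩ := Multiset.mem_map.1 hr
      exact neg_neg_of_pos (hs a ha))

/-- The half-plane theorem with `c = 0` is applied to the lower, upper and right open half-planes,
which excludes nonreal and positive roots. The root 0 is excluded by the constant coefficient. -/
theorem szComp_shiftProd {s : Multiset ℝ} (hs : ∀ a ∈ s, 0 < a) (hn : s.card = n)
    (hQ : IsHypNeg n Q) : IsHypNeg n (szComp n (_root_.shiftProd s) Q) := by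
  subst hn
  have hcoeff : (szComp s.card (_root_.shiftProd s) Q).coeff s.card ≠ 0 := by
    have h1 := (shiftProd_monic s).leadingCoeff
    rw [leadingCoeff, natDegree_shiftProd] at h1
    have h2 := leadingCoeff_ne_zero.2 hQ.ne_zero
    rw [leadingCoeff, hQ.natDegree_eq] at h2
    rw [coeff_szComp, h1]
    simpa using h2
  have hne : szComp s.card (_root_.shiftProd s) Q ≠ 0 := fun h => hcoeff (by rw [h, coeff_zero])
  have key := fun (u x : ℂ) (h : ∀ a ∈ s, a ≠ 0 ∧ (u * (x / a)).re < 0) =>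
    eval_map_szComp_shiftProd_ne_zero (u := u) (x := x) (c := 0) s h hQ.ne_zero hQ.natDegree_eq
      hQ.splits
  refine of_natDegree hne (le_antisymm ?_ (le_natDegree_of_ne_zero hcoeff)) ?_ ?_
  · rw [natDegree_le_iff_coeff_eq_zero]
    intro N hN
    rw [coeff_szComp, Nat.choose_eq_zero_of_lt hN]
    simp
  · refine splits_of_forall_im_eq_zero fun z hz => ?_
    by_contra him
    rcases lt_or_gt_of_ne him with h | h
    · refine key (-Complex.I) z (fun a ha => ⟨(hs a ha).ne', ?_⟩) (by simp) hz
      simpa using div_neg_of_neg_of_pos h (hs a ha)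
    · refine key Complex.I z (fun a ha => ⟨(hs a ha).ne', ?_⟩) (by simp) hz
      simpa using div_pos h (hs a ha)
  · intro r hr
    by_contra hr0
    rcases (not_lt.1 hr0).eq_or_lt with rfl | h
    · have h1 : ∀ R : ℝ[X], IsHypNeg s.card R → R.coeff 0 ≠ 0 := fun R hR h0 => by
        rw [coeff_zero_eq_eval_zero] at h0
        exact lt_irrefl _ (hR.2 0 h0)
      have h2 : (szComp s.card (_root_.shiftProd s) Q).coeff 0 = 0 := by
        rw [coeff_zero_eq_eval_zero]
        exact isRoot_of_mem_roots hr
      rw [coeff_szComp] at h2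
      simp [h1 _ hQ, h1 _ (shiftProd hs rfl)] at h2
    · refine key (-1) r (fun a ha => ⟨(hs a ha).ne', ?_⟩) (fun w hw => ?_) ?_
      · rw [← Complex.ofReal_div]
        simpa using div_pos h (hs a ha)
      · simpa using (hQ.neg_of_mem_roots hw).le
      · have := isRoot_of_mem_roots hr
        rw [← Complex.ofRealHom_eq_coe, eval_map_apply, IsRoot.def.1 this, map_zero]

theorem szComp (hP : IsHypNeg n P) (hQ : IsHypNeg n Q) : IsHypNeg n (szComp n P Q) := by
  obtain ⟨c, s, hc, hn, hs, rfl⟩ := hP.exists_eq_C_mul_shiftProd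
  rw [C_mul_szComp]
  exact (szComp_shiftProd hs hn hQ).C_mul hc

end IsHypNeg

/-! ### Vanishing at products of roots of large multiplicity -/

section Vanish

variable {K : Type*} [Field K]

theorem pow_dvd_polarDeriv_self {n k : ℕ} {y : K} {Q : K[X]} (h : (X - C y) ^ k ∣ Q) :
    (X - C y) ^ k ∣ polarDeriv n y Q := by
  refine dvd_sub (h.mul_left _) ?_
  rcases k with _ | k
  · rw [pow_zero]
    exact one_dvd _
  · have := mul_dvd_mul_left (X - C y) (pow_sub_one_dvd_derivative_of_pow_dvd h)
    rwa [← pow_succ'] at this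

theorem pow_sub_one_dvd_polarDeriv {n k : ℕ} {y b : K} {Q : K[X]} (h : (X - C b) ^ k ∣ Q) :
    (X - C b) ^ (k - 1) ∣ polarDeriv n y Q :=
  dvd_sub (((pow_dvd_pow _ (Nat.sub_le k 1)).trans h).mul_left _)
    ((pow_sub_one_dvd_derivative_of_pow_dvd h).mul_left _)

/-- A factor `X + C a` gives the pole `a * b / a = b`, which preserves the power of `X - C b`; any
other factor costs at most one. At the end a polynomial of degree at most 0 is still divisible by `X
- C b`. -/
theorem eval_szComp_shiftProd_eq_zero [CharZero K] [DecidableEq K] (s : Multiset K)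
    (hs : ∀ a ∈ s, a ≠ 0) {Q : K[X]} {k : ℕ} {a b : K} (hQ : Q.natDegree ≤ s.card)
    (hk : (X - C b) ^ k ∣ Q) (h : s.card < s.count a + k) :
    (szComp s.card (shiftProd s) Q).eval (a * b) = 0 := by
  induction s using Multiset.induction_on generalizing Q k with
  | empty =>
    have : Q = 0 := by
      by_contra h0
      have h1 := natDegree_le_of_dvd hk h0
      rw [natDegree_pow, natDegree_X_sub_C, mul_one] at h1
      simp at h hQ
      omega
    simp [this, szComp_zero]
  | cons c t ih =>
    have hc := hs c (by simp)
    rw [Multiset.card_cons] at *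
    rw [shiftProd_cons]
    have h1 := succ_mul_eval_szComp (natDegree_shiftProd t).le hc Q (a * b)
    have h2 : (szComp t.card (shiftProd t) (polarDeriv (t.card + 1) (a * b / c) Q)).eval (a * b)
        = 0 := by
      have hd := natDegree_polarDeriv_le hQ (a * b / c)
      rcases eq_or_ne a c with rfl | hac
      · rw [Multiset.count_cons_self] at h
        refine ih (fun a ha => hs a (by simp [ha])) hd (k := k) ?_ (by omega)
        rw [mul_div_cancel_left₀ _ hc]
        exact pow_dvd_polarDeriv_self hk
      · rw [Multiset.count_cons_of_ne hac] at h
        have := Multiset.count_le_card a t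
        exact ih (fun a ha => hs a (by simp [ha])) hd (pow_sub_one_dvd_polarDeriv hk) (by omega)
    rw [h2, mul_zero] at h1
    exact (mul_eq_zero.1 h1).resolve_left (by exact_mod_cast Nat.succ_ne_zero t.card)

end Vanish

/-! ### Derivatives, and the lower bound for the multiplicity at a product of roots -/

namespace IsHypNeg

variable {n : ℕ} {P Q : ℝ[X]}

theorem derivative (hP : IsHypNeg (n + 1) P) : IsHypNeg n P.derivative := by
  have hd : P.derivative.natDegree = n := by
    rw [natDegree_derivative, hP.natDegree_eq, Nat.add_sub_cancel]
  have hpos : ∀ x : ℝ, 0 ≤ x → P.derivative.eval x ≠ 0 := by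
    intro x hx h
    have hPx : P.eval x ≠ 0 := fun h0 => (hP.2 x h0).not_ge hx
    have h1 := hP.splits.eval_derivative_div_eval_of_ne_zero hPx
    rw [h, zero_div] at h1
    have hne : P.roots ≠ ∅ := by
      intro h0
      have := hP.card_roots
      rw [h0] at this
      simp at this
    have := Multiset.sum_lt_sum_of_nonempty (f := fun _ => (0 : ℝ))
      (g := fun z => 1 / (x - z)) hne (fun r hr => by
        have := hP.neg_of_mem_roots hr
        exact one_div_pos.2 (by linarith))
    simp at this h1
    linarith
  have h0 : P.derivative ≠ 0 := fun h => hpos 0 le_rfl (by rw [h, eval_zero])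
  refine of_natDegree h0 hd ?_ fun r hr => ?_
  · rw [splits_iff_card_roots]
    refine le_antisymm (card_roots' _) ?_
    have := card_roots_le_derivative P
    rw [hP.card_roots] at this
    omega
  · by_contra h
    exact hpos r (not_lt.1 h) (isRoot_of_mem_roots hr)

theorem rootMultiplicity_le (hP : IsHypNeg n P) (r : ℝ) : P.rootMultiplicity r ≤ n := by
  classical
  rw [← count_roots, ← hP.card_roots]
  exact Multiset.count_le_card _ _

theorem isRoot_szComp (hP : IsHypNeg n P) (hQ : IsHypNeg n Q) {a b : ℝ}
    (h : n < P.rootMultiplicity a + Q.rootMultiplicity b) :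
    (_root_.szComp n P Q).IsRoot (-(a * b)) := by
  classical
  obtain ⟨c, s, hc, hn, hs, rfl⟩ := hP.exists_eq_C_mul_shiftProd
  subst hn
  rw [← count_roots, roots_C_mul _ hc, count_roots, ← neg_neg a,
    rootMultiplicity_shiftProd] at h
  have := eval_szComp_shiftProd_eq_zero s (fun a ha => (hs a ha).ne') hQ.natDegree_eq.le
    (pow_rootMultiplicity_dvd Q b) h
  rw [IsRoot.def, C_mul_szComp, eval_mul, ← neg_mul, this, mul_zero]

theorem C_mul_derivative_szComp (n : ℕ) (P Q : ℝ[X]) :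
    ((_root_.szComp (n + 1) P Q).derivative) = C ((n : ℝ) + 1)⁻¹ *
      _root_.szComp n (Polynomial.derivative P) (Polynomial.derivative Q) := by
  rw [← succ_mul_derivative_szComp, ← mul_assoc, ← Polynomial.C_mul, inv_mul_cancel₀ (by positivity), C_1,
    one_mul]

theorem rootMultiplicity_derivative_szComp (n : ℕ) (P Q : ℝ[X]) (x : ℝ) :
    (_root_.szComp (n + 1) P Q).derivative.rootMultiplicity x =
      (_root_.szComp n (Polynomial.derivative P) (Polynomial.derivative Q)).rootMultiplicity x := by
  classical
  rw [C_mul_derivative_szComp, ← count_roots, roots_C_mul _ (by positivity), count_roots]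

/-- Differentiating composes the derivatives in formal degree one less. Both multiplicities and `n`
then drop by at most one, so the excess drops by at most one, as does the multiplicity of the root
of the composition. -/
theorem rootMultiplicity_add_le (hP : IsHypNeg n P) (hQ : IsHypNeg n Q) (a b : ℝ) :
    P.rootMultiplicity a + Q.rootMultiplicity b ≤
      n + (_root_.szComp n P Q).rootMultiplicity (-(a * b)) := by
  induction n generalizing P Q with
  | zero =>
    have := hP.rootMultiplicity_le a
    have := hQ.rootMultiplicity_le b
    omega
  | succ n ih =>
    by_contra! hlt
    have hroot := isRoot_szComp hP hQ (a := a) (b := b) (by omega)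
    have h1 := derivative_rootMultiplicity_of_root hroot
    rw [rootMultiplicity_derivative_szComp] at h1
    have h2 := ih hP.derivative hQ.derivative
    have h3 := rootMultiplicity_sub_one_le_derivative_rootMultiplicity P a
    have h4 := rootMultiplicity_sub_one_le_derivative_rootMultiplicity Q b
    have h5 := hP.rootMultiplicity_le a
    have h6 := hQ.rootMultiplicity_le b
    have h7 := (rootMultiplicity_pos (hP.szComp hQ).ne_zero).2 hroot
    omega

end IsHypNeg

/-! ### Polar derivatives of real-rooted polynomials -/

/-- Zero variance forces constancy. Fewer than `N` vectors are allowed because a polar derivative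
may lose degree, which amounts to roots at infinity contributing zero vectors. -/
theorem forall_eq_of_sum_norm_sq_le {E : Type*} [NormedAddCommGroup E] [InnerProductSpace ℝ E]
    (s : Multiset E) {N : ℕ} {v : E} (hc : s.card ≤ N) (hs : s.sum = N • v)
    (hq : (s.map fun e => ‖e‖ ^ 2).sum ≤ N * ‖v‖ ^ 2) :
    (∀ e ∈ s, e = v) ∧ (s.card = N ∨ v = 0) := by
  have h1 : (s.map fun e => ‖e - v‖ ^ 2).sum =
      (s.map fun e => ‖e‖ ^ 2).sum - 2 * inner ℝ s.sum v + s.card * ‖v‖ ^ 2 := by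
    clear hc hs hq
    induction s using Multiset.induction_on with
    | empty => simp
    | cons a s ih =>
      simp only [Multiset.map_cons, Multiset.sum_cons, ih, inner_add_left, Multiset.card_cons]
      rw [norm_sub_sq_real]
      push_cast
      ring
  have hnn : ∀ x ∈ s.map fun e => ‖e - v‖ ^ 2, 0 ≤ x := by
    intro x hx
    obtain ⟨e, -, rfl⟩ := Multiset.mem_map.1 hx
    positivity
  have h2 := Multiset.sum_nonneg hnn
  rw [hs, ← Nat.cast_smul_eq_nsmul ℝ, inner_smul_left, real_inner_self_eq_norm_sq] at h1
  simp only [conj_trivial] at h1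
  have h3 : ((s.card : ℝ) - N) * ‖v‖ ^ 2 ≤ 0 :=
    mul_nonpos_of_nonpos_of_nonneg (sub_nonpos.2 (by exact_mod_cast hc)) (by positivity)
  refine ⟨fun e he => ?_, ?_⟩
  · have h4 := Multiset.single_le_sum hnn (‖e - v‖ ^ 2) (Multiset.mem_map_of_mem _ he)
    have h5 : ‖e - v‖ ^ 2 = 0 := le_antisymm (by linarith) (by positivity)
    simpa [sub_eq_zero] using h5
  · have h4 : ((s.card : ℝ) - N) * ‖v‖ ^ 2 = 0 := by linarith
    rcases mul_eq_zero.1 h4 with h | h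
    · left
      exact_mod_cast sub_eq_zero.1 h
    · right
      simpa using h

theorem polarDeriv_eq_zero_of_roots_eq {K : Type*} [Field K] {Q : K[X]} (hQ : Q.Splits) {y : K}
    {N : ℕ} (hN : Q.roots.card = N) (h : ∀ r ∈ Q.roots, r = y) : polarDeriv N y Q = 0 := by
  rw [hQ.eq_prod_roots, Multiset.eq_replicate.2 ⟨hN, h⟩]
  rcases N with _ | N
  · simp [polarDeriv]
  · simp only [polarDeriv, Multiset.map_replicate, Multiset.prod_replicate, derivative_C_mul,
      derivative_X_sub_C_pow, Nat.add_sub_cancel]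
    ring

@[simp] theorem polarDeriv_zero {K : Type*} [Field K] (N : ℕ) (y : K) :
    polarDeriv N y (0 : K[X]) = 0 := by simp [polarDeriv]

theorem map_polarDeriv {K L : Type*} [Field K] [Field L] (f : K →+* L) (N : ℕ) (y : K) (Q : K[X]) :
    (polarDeriv N y Q).map f = polarDeriv N (f y) (Q.map f) := by
  simp [polarDeriv, derivative_map]

theorem im_mul_norm_sq_one_div_sub (z : ℂ) (r : ℝ) :
    z.im * ‖1 / (z - r)‖ ^ 2 = -(1 / (z - r)).im := by
  rw [one_div, Complex.inv_im, ← Complex.normSq_eq_norm_sq, Complex.normSq_inv]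
  simp
  ring

/-- At a nonreal zero `z` the numbers `1 / (z - r)` sum to `N / (z - y)`. For real `r` the imaginary
part of `1 / (z - r)` is `-z.im` times its squared norm, so imaginary parts give the same relation
for squared norms. Zero variance then puts all roots at the pole, where the polar derivative
vanishes identically. -/
theorem splits_polarDeriv {Q : ℝ[X]} (hQ : Q.Splits) {N : ℕ} (hN : Q.natDegree ≤ N) (y : ℝ) :
    (polarDeriv N y Q).Splits := by
  rcases eq_or_ne Q 0 with rfl | hQ0
  · simp
  rcases eq_or_ne (polarDeriv N y Q) 0 with hp0 | hp0
  · rw [hp0]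
    exact Splits.zero
  refine splits_of_forall_im_eq_zero fun z hz => ?_
  by_contra him
  set F := Q.map Complex.ofRealHom with hF
  have hFs : F.Splits := hQ.map _
  have hF0 : F ≠ 0 := (Polynomial.map_ne_zero_iff Complex.ofRealHom.injective).2 hQ0
  have hFr : F.roots = Q.roots.map Complex.ofRealHom := hQ.roots_map _
  have hFz : F.eval z ≠ 0 := by
    intro h
    have h1 : z ∈ F.roots := (mem_roots hF0).2 h
    rw [hFr] at h1
    obtain ⟨r, -, rfl⟩ := Multiset.mem_map.1 h1
    simp at him
  have hzy : z - y ≠ 0 := by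
    intro h
    rw [sub_eq_zero.1 h] at him
    simp at him
  have hcard : F.roots.card ≤ N := by
    rw [hFr, Multiset.card_map, ← hQ.natDegree_eq_card_roots]
    exact hN
  rw [map_polarDeriv] at hz
  have hsum : (F.roots.map fun w => 1 / (z - w)).sum = N • (1 / (z - y)) := by
    rw [← hFs.eval_derivative_div_eval_of_ne_zero hFz, nsmul_eq_mul]
    simp only [polarDeriv, eval_sub, eval_mul, eval_C, eval_X, Complex.ofRealHom_eq_coe] at hz
    field_simp
    linear_combination -hz
  have hsq : ((F.roots.map fun w => 1 / (z - w)).map fun e => ‖e‖ ^ 2).sum ≤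
      N * ‖1 / (z - y)‖ ^ 2 := by
    refine le_of_eq (mul_left_cancel₀ him ?_)
    rw [mul_left_comm, im_mul_norm_sq_one_div_sub, ← Multiset.sum_map_mul_left, Multiset.map_map]
    have h1 := congr_arg Complex.im hsum
    rw [show ∀ s : Multiset ℂ, s.sum.im = (s.map Complex.im).sum from
      fun s => map_multiset_sum Complex.imAddGroupHom s, Multiset.map_map, nsmul_eq_mul,
      ← Complex.ofReal_natCast, Complex.im_ofReal_mul] at h1
    rw [mul_neg, ← h1, ← Multiset.sum_map_neg', hFr, Multiset.map_map, Multiset.map_map, Multiset.map_map]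
    refine congr_arg _ (Multiset.map_congr rfl fun r _ => ?_)
    exact im_mul_norm_sq_one_div_sub z r
  obtain ⟨h1, h2⟩ := forall_eq_of_sum_norm_sq_le _ (by rwa [Multiset.card_map]) hsum hsq
  rw [Multiset.card_map] at h2
  have h3 := h2.resolve_right (one_div_ne_zero hzy)
  have h4 : polarDeriv N (y : ℂ) F = 0 := polarDeriv_eq_zero_of_roots_eq hFs h3 fun r hr => by
    have := h1 _ (Multiset.mem_map_of_mem _ hr)
    simpa using this
  refine hp0 ((Polynomial.map_eq_zero_iff Complex.ofRealHom.injective).1 ?_)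
  rw [map_polarDeriv]
  exact h4

/-- This is the second logarithmic derivative, cleared of denominators. -/
theorem eval_derivative_sq_sub {Q : ℝ[X]} (hQ : Q.Splits) {x : ℝ} (hx : Q.eval x ≠ 0) :
    (Q.derivative.eval x) ^ 2 - Q.eval x * Q.derivative.derivative.eval x =
      Q.eval x ^ 2 * ((Q.roots.map fun r => 1 / (x - r)).map fun e => ‖e‖ ^ 2).sum := by
  have key : ∀ s : Multiset ℝ, (∀ r ∈ s, x ≠ r) → ∀ F : ℝ[X], F = (s.map fun r => X - C r).prod →
      (F.derivative.eval x) ^ 2 - F.eval x * F.derivative.derivative.eval x =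
      F.eval x ^ 2 * ((s.map fun r => 1 / (x - r)).map fun e => ‖e‖ ^ 2).sum := by
    intro s
    induction s using Multiset.induction_on with
    | empty => rintro - F rfl; simp
    | cons a s ih =>
      rintro hs F rfl
      have h1 := ih (fun r hr => hs r (by simp [hr])) _ rfl
      have h2 : x - a ≠ 0 := sub_ne_zero.2 (hs a (by simp))
      simp only [Multiset.map_cons, Multiset.prod_cons, Multiset.sum_cons]
      set G := (s.map fun r => X - C r).prod
      simp only [derivative_mul, derivative_X_sub_C, one_mul, derivative_add, eval_add, eval_mul,
        eval_sub, eval_X, eval_C, Real.norm_eq_abs, sq_abs, mul_add] at h1 ⊢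
      have h3 : (x - a) ^ 2 * (1 / (x - a)) ^ 2 = 1 := by field_simp
      linear_combination (x - a) ^ 2 * h1 - eval x G ^ 2 * h3
  have h0 : ∀ r ∈ Q.roots, x ≠ r := by
    rintro r hr rfl
    exact hx (isRoot_of_mem_roots hr)
  have h1 := key Q.roots h0 _ rfl
  set G := (Q.roots.map fun r => X - C r).prod
  have hQG : Q = C Q.leadingCoeff * G := hQ.eq_prod_roots
  have e0 : Q.eval x = Q.leadingCoeff * G.eval x := by
    conv_lhs => rw [hQG]
    simp
  have e1 : Q.derivative.eval x = Q.leadingCoeff * G.derivative.eval x := by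
    conv_lhs => rw [hQG]
    simp
  have e2 : Q.derivative.derivative.eval x =
      Q.leadingCoeff * G.derivative.derivative.eval x := by
    conv_lhs => rw [hQG]
    simp
  rw [e0, e1, e2]
  linear_combination Q.leadingCoeff ^ 2 * h1

/-- A multiple root of a polar derivative of a real-rooted polynomial, other than the pole, is a
root of the polynomial itself. -/
theorem isRoot_of_polarDeriv_double_root {Q : ℝ[X]} (hQ : Q.Splits) {N : ℕ}
    (hN : Q.natDegree ≤ N + 1) {y b : ℝ} (hby : b ≠ y) (h0 : polarDeriv (N + 1) y Q ≠ 0)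
    (h1 : (polarDeriv (N + 1) y Q).eval b = 0)
    (h2 : (polarDeriv (N + 1) y Q).derivative.eval b = 0) : Q.eval b = 0 := by
  by_contra hb
  have hyb : b - y ≠ 0 := sub_ne_zero.2 hby
  have hsum : (Q.roots.map fun r => 1 / (b - r)).sum = (N + 1) • (1 / (b - y)) := by
    rw [← hQ.eval_derivative_div_eval_of_ne_zero hb, nsmul_eq_mul]
    simp only [polarDeriv, eval_sub, eval_mul, eval_C, eval_X] at h1
    field_simp
    linear_combination -h1
  have e1 : Q.derivative.eval b = (N + 1) * (1 / (b - y)) * Q.eval b := by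
    rw [hQ.eval_derivative_eq_eval_mul_sum hb, hsum, nsmul_eq_mul]
    push_cast
    ring
  have e2 : Q.derivative.derivative.eval b = N * (1 / (b - y)) * Q.derivative.eval b := by
    rw [derivative_polarDeriv] at h2
    simp only [polarDeriv, eval_sub, eval_mul, eval_C, eval_X] at h2
    field_simp
    linear_combination -h2
  -- With `t = 1 / (b - y)`, the relations `Q' = (N + 1) t Q` and `Q'' = N t Q'` at `b` give the sum
  -- of squares `((N + 1)^2 - N (N + 1)) t^2 = (N + 1) t^2`, the case of zero variance.
  have hsq := eval_derivative_sq_sub hQ hb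
  obtain ⟨h3, h4⟩ := forall_eq_of_sum_norm_sq_le _ (N := N + 1)
    (by rw [Multiset.card_map, ← hQ.natDegree_eq_card_roots]; exact hN) hsum (by
      refine le_of_eq (mul_left_cancel₀ (pow_ne_zero 2 hb) ?_)
      rw [← hsq, e2, e1, Real.norm_eq_abs, sq_abs]
      push_cast
      ring)
  rw [Multiset.card_map] at h4
  refine h0 (polarDeriv_eq_zero_of_roots_eq hQ (h4.resolve_right (one_div_ne_zero hyb))
    fun r hr => ?_)
  have := h3 _ (Multiset.mem_map_of_mem _ hr)
  simpa using this

theorem rootMultiplicity_eq_of_eq_mul {K : Type*} [Field K] {F G : K[X]} {a : K} {k : ℕ}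
    (h : F = (X - C a) ^ k * G) (hG : G.eval a ≠ 0) : F.rootMultiplicity a = k := by
  have hG0 : G ≠ 0 := by rintro rfl; simp at hG
  rw [h, mul_comm, rootMultiplicity_mul_X_sub_C_pow hG0, rootMultiplicity_eq_zero hG, zero_add]

theorem exists_eq_pow_mul_eval_ne_zero {K : Type*} [Field K] {F : K[X]} (hF : F ≠ 0) (a : K) :
    ∃ G : K[X], F = (X - C a) ^ F.rootMultiplicity a * G ∧ G.eval a ≠ 0 := by
  obtain ⟨G, h1, h2⟩ := exists_eq_pow_rootMultiplicity_mul_and_not_dvd F hF a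
  exact ⟨G, h1, fun h => h2 (dvd_iff_isRoot.2 h)⟩

theorem polarDeriv_pow_mul {K : Type*} [Field K] (N k : ℕ) (y : K) (R : K[X]) :
    polarDeriv N y ((X - C y) ^ k * R) =
      (X - C y) ^ k * (C ((N : K) - k) * R - (X - C y) * derivative R) := by
  rw [polarDeriv]
  rcases k with _ | k
  · simp
  · simp only [derivative_mul, derivative_X_sub_C_pow, Nat.add_sub_cancel, C_sub]
    ring

theorem rootMultiplicity_of_polarDeriv_eq_zero {K : Type*} [Field K] [CharZero K] {Q : K[X]}
    (hQ : Q ≠ 0) {N : ℕ} {y : K} (h0 : polarDeriv N y Q = 0) : Q.rootMultiplicity y = N := by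
  obtain ⟨R, hR, hRy⟩ := exists_eq_pow_mul_eval_ne_zero hQ y
  have hpol := polarDeriv_pow_mul N (Q.rootMultiplicity y) y R
  rw [← hR, h0, zero_eq_mul] at hpol
  have h1 := congr_arg (eval y) (hpol.resolve_left (pow_ne_zero _ (X_sub_C_ne_zero y)))
  simp only [eval_sub, eval_mul, eval_C, eval_X, sub_self, zero_mul, sub_zero, eval_zero] at h1
  have := sub_eq_zero.1 ((mul_eq_zero.1 h1).resolve_right hRy)
  exact_mod_cast this.symm

theorem rootMultiplicity_polarDeriv_self {K : Type*} [Field K] [CharZero K] {Q : K[X]} {N : ℕ}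
    (hN : Q.natDegree ≤ N) {y : K} (h0 : polarDeriv N y Q ≠ 0) :
    (polarDeriv N y Q).rootMultiplicity y = Q.rootMultiplicity y := by
  have hQ : Q ≠ 0 := by rintro rfl; simp at h0
  obtain ⟨R, hR, hRy⟩ := exists_eq_pow_mul_eval_ne_zero hQ y
  have hR0 : R ≠ 0 := by rintro rfl; simp at hRy
  set k := Q.rootMultiplicity y with hk
  have hpol := polarDeriv_pow_mul N k y R
  rw [← hR] at hpol
  have hkN : k ≠ N := by
    intro hkN
    have hd := congr_arg natDegree hR
    rw [natDegree_mul (pow_ne_zero _ (X_sub_C_ne_zero y)) hR0, natDegree_pow, natDegree_X_sub_C,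
      mul_one] at hd
    have : R.natDegree = 0 := by omega
    apply h0
    rw [hpol, hkN, sub_self, derivative_of_natDegree_zero this]
    simp
  refine rootMultiplicity_eq_of_eq_mul hpol ?_
  simp only [eval_sub, eval_mul, eval_C, eval_X, sub_self, zero_mul, sub_zero]
  refine mul_ne_zero (sub_ne_zero.2 ?_) hRy
  exact_mod_cast hkN.symm

theorem rootMultiplicity_polarDeriv_of_isRoot {K : Type*} [Field K] [CharZero K] {Q : K[X]}
    (hQ : Q ≠ 0) (N : ℕ) {y b : K} (hby : b ≠ y) (hb : Q.IsRoot b) :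
    (polarDeriv N y Q).rootMultiplicity b + 1 = Q.rootMultiplicity b := by
  obtain ⟨R, hR, hRb⟩ := exists_eq_pow_mul_eval_ne_zero hQ b
  obtain ⟨k, hk⟩ := Nat.exists_eq_succ_of_ne_zero ((rootMultiplicity_pos hQ).2 hb).ne'
  rw [hk] at hR ⊢
  have hpol : polarDeriv N y Q = (X - C b) ^ k *
      (C (N : K) * (X - C b) * R - (X - C y) * (C ((k : K) + 1) * R + (X - C b) * derivative R)) := by
    rw [hR, polarDeriv]
    simp only [derivative_mul, derivative_X_sub_C_pow, Nat.succ_eq_add_one, Nat.add_sub_cancel]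
    push_cast
    ring
  rw [rootMultiplicity_eq_of_eq_mul hpol]
  simp only [eval_sub, eval_mul, eval_add, eval_C, eval_X, sub_self, zero_mul, mul_zero, zero_sub,
    add_zero]
  refine neg_ne_zero.2 (mul_ne_zero (sub_ne_zero.2 hby) (mul_ne_zero ?_ hRb))
  exact_mod_cast Nat.succ_ne_zero k

theorem rootMultiplicity_polarDeriv_lt {Q : ℝ[X]} (hQ : Q.Splits) {N : ℕ}
    (hN : Q.natDegree ≤ N + 1) {y b : ℝ} (hby : b ≠ y) (h0 : polarDeriv (N + 1) y Q ≠ 0)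
    (h2 : 2 ≤ (polarDeriv (N + 1) y Q).rootMultiplicity b) :
    (polarDeriv (N + 1) y Q).rootMultiplicity b + 1 = Q.rootMultiplicity b := by
  obtain ⟨h3, h4⟩ := (one_lt_rootMultiplicity_iff_isRoot h0).1 h2
  refine rootMultiplicity_polarDeriv_of_isRoot ?_ _ hby
    (isRoot_of_polarDeriv_double_root hQ hN hby h0 h3 h4)
  rintro rfl
  simp at h0

/-- If all polarizations of `Q` with one argument missing vanish, then one of the poles is a root
of large multiplicity. -/
theorem exists_le_count_add_rootMultiplicity (s : Multiset ℝ) (hs : ∀ a ∈ s, a ≠ 0) {Q : ℝ[X]}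
    (hQ : Q.Splits) (hQ0 : Q ≠ 0) (hN : Q.natDegree ≤ s.card + 1) {x : ℝ} (hx : x ≠ 0)
    (h1 : (szComp s.card (shiftProd s) (derivative Q)).eval x = 0)
    (h2 : (szComp s.card (shiftProd s) (polarDeriv (s.card + 1) 0 Q)).eval x = 0) :
    ∃ a b : ℝ, a * b = x ∧ s.card + 2 ≤ s.count a + Q.rootMultiplicity b := by
  induction s using Multiset.induction_on generalizing Q with
  | empty =>
    -- With no poles left, the two hypotheses are the vanishing of both coefficients of a polynomial
    -- of degree at most 1.
    exfalso
    rw [Multiset.card_zero, zero_add] at *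
    have e1 : Q.coeff 1 = 0 := by
      simpa [szComp, coeff_derivative] using h1
    have e0 : Q.coeff 0 = 0 := by
      simpa [szComp, coeff_polarDeriv_zero] using h2
    apply hQ0
    ext i
    rcases i with _ | _ | i
    · simpa using e0
    · simpa using e1
    · rw [coeff_zero]
      exact coeff_eq_zero_of_natDegree_lt (by omega)
  | cons c t ih =>
    have hc := hs c (by simp)
    rw [Multiset.card_cons] at *
    rw [shiftProd_cons] at h1 h2
    have k1 := succ_mul_eval_szComp (natDegree_shiftProd t).le hc (derivative Q) x
    have k2 := succ_mul_eval_szComp (natDegree_shiftProd t).le hc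
      (polarDeriv (t.card + 1 + 1) 0 Q) x
    rw [h1, mul_zero, ← derivative_polarDeriv] at k1
    rw [h2, mul_zero, polarDeriv_comm] at k2
    have hcx : c * (x / c) = x := by field_simp
    by_cases h0 : polarDeriv (t.card + 1 + 1) (x / c) Q = 0
    · refine ⟨c, x / c, hcx, ?_⟩
      rw [rootMultiplicity_of_polarDeriv_eq_zero hQ0 h0, Multiset.count_cons_self]
      omega
    · obtain ⟨a, b, hab, hle⟩ := ih (fun a ha => hs a (by simp [ha]))
        (splits_polarDeriv hQ hN (x / c)) h0 (natDegree_polarDeriv_le hN _)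
        ((mul_eq_zero.1 k1.symm).resolve_left hc) ((mul_eq_zero.1 k2.symm).resolve_left hc)
      refine ⟨a, b, hab, ?_⟩
      have hct := Multiset.count_le_card a t
      rcases eq_or_ne b (x / c) with rfl | hb
      · rw [rootMultiplicity_polarDeriv_self hN h0] at hle
        have hac : a = c := by
          have : x / c ≠ 0 := div_ne_zero hx hc
          exact mul_right_cancel₀ this (hab.trans hcx.symm)
        rw [hac, Multiset.count_cons_self]
        rw [hac] at hle
        omega
      -- Since `t.count a ≤ t.card`, the multiplicity of `b` in the polar derivative is at least 2.
      -- So `b` is a root of `Q` with multiplicity one larger, which pays for the extra factor.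
      · have := rootMultiplicity_polarDeriv_lt hQ hN hb h0 (by omega)
        have := Multiset.count_le_count_cons a c t
        omega

/-! ### Rayleigh and Wronskian inequalities, and multiple roots of the composition -/

theorem four_mul_coeff_le_sq {Q : ℝ[X]} (hQ : Q.Splits) (hN : Q.natDegree ≤ 2) :
    4 * (Q.coeff 0 * Q.coeff 2) ≤ Q.coeff 1 ^ 2 := by
  by_cases h2 : Q.coeff 2 = 0
  · rw [h2]
    nlinarith [sq_nonneg (Q.coeff 1)]
  · have hd : Q.natDegree = 2 := le_antisymm hN (le_natDegree_of_ne_zero h2)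
    obtain ⟨r, hr⟩ := hQ.exists_eval_eq_zero (by
      rw [degree_eq_natDegree (by rintro rfl; simp at h2), hd]
      norm_num)
    rw [eval_eq_sum_range, hd] at hr
    simp only [Finset.sum_range_succ, Finset.sum_range_zero, zero_add, pow_zero, mul_one,
      pow_one] at hr
    have : Q.coeff 1 ^ 2 - 4 * (Q.coeff 0 * Q.coeff 2) = (2 * Q.coeff 2 * r + Q.coeff 1) ^ 2 := by
      linear_combination -4 * Q.coeff 2 * hr
    nlinarith [sq_nonneg (2 * Q.coeff 2 * r + Q.coeff 1)]

/-- Polarizing `Q` at the poles coming from `s` leaves a real-rooted polynomial of degree at most 2;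
the inequality says that its discriminant is nonnegative. -/
theorem eval_szComp_mul_le_sq (s : Multiset ℝ) (hs : ∀ a ∈ s, a ≠ 0) {Q : ℝ[X]} (hQ : Q.Splits)
    (hN : Q.natDegree ≤ s.card + 2) (x : ℝ) :
    (szComp s.card (shiftProd s) (polarDeriv (s.card + 1) 0 (polarDeriv (s.card + 2) 0 Q))).eval x *
      (szComp s.card (shiftProd s) Q.derivative.derivative).eval x ≤
    (szComp s.card (shiftProd s) (polarDeriv (s.card + 1) 0 Q.derivative)).eval x ^ 2 := by
  induction s using Multiset.induction_on generalizing Q with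
  | empty =>
    have := four_mul_coeff_le_sq hQ (by simpa using hN)
    simp [szComp, coeff_polarDeriv_zero, coeff_derivative]
    linarith
  | cons c t ih =>
    have hc := hs c (by simp)
    rw [Multiset.card_cons] at *
    rw [shiftProd_cons]
    have key := fun f => succ_mul_eval_szComp (natDegree_shiftProd t).le hc f x
    have h := ih (fun a ha => hs a (by simp [ha])) (splits_polarDeriv hQ hN (x / c))
      (natDegree_polarDeriv_le hN _)
    rw [derivative_polarDeriv, derivative_polarDeriv, polarDeriv_comm (t.card + 1 + 1) 0,
      polarDeriv_comm (t.card + 1) 0 (x / c), polarDeriv_comm (t.card + 1) 0 (x / c)] at h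
    have k1 := key (polarDeriv (t.card + 1 + 1) 0 (polarDeriv (t.card + 1 + 2) 0 Q))
    have k2 := key (polarDeriv (t.card + 1 + 1) 0 Q.derivative)
    have k3 := key Q.derivative.derivative
    have aux : ∀ {m A' B' D' A B D : ℝ}, 0 < m → m * A' = c * A → m * B' = c * B →
        m * D' = c * D → A * D ≤ B ^ 2 → A' * D' ≤ B' ^ 2 := by
      intro m A' B' D' A B D hm hA hB hD hle
      refine le_of_mul_le_mul_left ?_ (pow_pos hm 2)
      have e1 : m ^ 2 * (A' * D') = c ^ 2 * (A * D) := by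
        linear_combination m * D' * hA + c * A * hD
      have e2 : m ^ 2 * B' ^ 2 = c ^ 2 * B ^ 2 := by
        rw [← mul_pow, hB, mul_pow]
      rw [e1, e2]
      exact mul_le_mul_of_nonneg_left hle (sq_nonneg c)
    exact aux (by positivity) k1 k2 k3 h

/-- The Rayleigh inequality. Expanding the factors `X + C a` and `X + C b` by the recursion, the two
sides differ by `a * b` times the discriminant bound. -/
theorem mul_eval_szComp_mul_le {a b : ℝ} (ha : 0 < a) (hb : 0 < b) (s : Multiset ℝ)
    (hs : ∀ a ∈ s, a ≠ 0) {Q : ℝ[X]} (hQ : Q.Splits) (hN : Q.natDegree ≤ s.card + 2) (x : ℝ) :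
    ((s.card : ℝ) + 2) * (szComp (s.card + 2) (shiftProd (a ::ₘ b ::ₘ s)) Q).eval x *
        (szComp s.card (shiftProd s) Q.derivative.derivative).eval x ≤
      ((s.card : ℝ) + 1) * ((szComp (s.card + 1) (shiftProd (b ::ₘ s)) Q.derivative).eval x *
        (szComp (s.card + 1) (shiftProd (a ::ₘ s)) Q.derivative).eval x) := by
  have hR := eval_szComp_mul_le_sq s hs hQ hN x
  have key := fun c f => congr_arg (eval x)
    (succ_mul_szComp_X_add_C_mul (natDegree_shiftProd s).le c f)
  have hd : (shiftProd (b ::ₘ s)).natDegree ≤ s.card + 1 := by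
    rw [natDegree_shiftProd, Multiset.card_cons]
  have k0 := congr_arg (eval x) (succ_mul_szComp_X_add_C_mul hd a Q)
  have k1 := key b (polarDeriv (s.card + 2) 0 Q)
  have k2 := key b Q.derivative
  have k3 := key a Q.derivative
  simp only [← shiftProd_cons, eval_mul, eval_add, eval_C, eval_X, derivative_polarDeriv] at k0 k1 k2 k3
  push_cast at k0
  have hm : (0 : ℝ) < (s.card : ℝ) + 1 := by positivity
  refine le_of_mul_le_mul_left ?_ hm
  set A := eval x (szComp s.card (shiftProd s)
    (polarDeriv (s.card + 1) 0 (polarDeriv (s.card + 2) 0 Q)))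
  set B := eval x (szComp s.card (shiftProd s) (polarDeriv (s.card + 1) 0 Q.derivative))
  set D := eval x (szComp s.card (shiftProd s) Q.derivative.derivative)
  set U := eval x (szComp (s.card + 1) (shiftProd (b ::ₘ s)) Q.derivative)
  set V := eval x (szComp (s.card + 1) (shiftProd (a ::ₘ s)) Q.derivative)
  set W := eval x (szComp (s.card + 2) (shiftProd (a ::ₘ b ::ₘ s)) Q)
  have e1 : ((s.card : ℝ) + 1) * (((s.card : ℝ) + 2) * W) = x * (x * D + b * B) +
      a * (x * B + b * A) := by
    rw [← k1, ← k2]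
    linear_combination ((s.card : ℝ) + 1) * k0
  calc _ = (((s.card : ℝ) + 1) * (((s.card : ℝ) + 2) * W)) * D := by ring
    _ = (x * D + b * B) * (x * D + a * B) - a * b * (B ^ 2 - A * D) := by rw [e1]; ring
    _ ≤ (x * D + b * B) * (x * D + a * B) := by
      have := mul_nonneg (mul_pos ha hb).le (sub_nonneg.2 hR)
      linarith
    _ = _ := by rw [← k2, ← k3]; ring

/-- The derivative of the product over `a ::ₘ s` is a sum over its factors. The factor of `a`
contributes the square, and each `b ∈ s` contributes a term that is nonnegative by the Rayleigh
inequality for `a` and `b`. -/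
theorem sq_le_wronskian {a : ℝ} (ha : 0 < a) (s : Multiset ℝ) (hs : ∀ a ∈ s, 0 < a) {Q : ℝ[X]}
    (hQ : Q.Splits) (hN : Q.natDegree ≤ s.card + 1) (x : ℝ) :
    (szComp s.card (shiftProd s) Q.derivative).eval x ^ 2 ≤ ((s.card : ℝ) + 1) *
      ((szComp (s.card + 1) (shiftProd (a ::ₘ s)) Q).derivative.eval x *
        (szComp s.card (shiftProd s) Q.derivative).eval x -
      (szComp s.card (shiftProd s) Q.derivative).derivative.eval x *
        (szComp (s.card + 1) (shiftProd (a ::ₘ s)) Q).eval x) := by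
  classical
  have h1 := congr_arg (eval x) (succ_mul_derivative_szComp s.card (shiftProd (a ::ₘ s)) Q)
  rw [shiftProd_cons, derivative_mul, derivative_X_add_C, one_mul, add_szComp] at h1
  simp only [eval_mul, eval_C, eval_add] at h1
  rw [← shiftProd_cons] at h1
  set U := eval x (szComp s.card (shiftProd s) Q.derivative) with hU
  set W := eval x (szComp (s.card + 1) (shiftProd (a ::ₘ s)) Q) with hW
  suffices h : 0 ≤ eval x (szComp s.card ((X + C a) * derivative (shiftProd s)) Q.derivative) * U -
      ((s.card : ℝ) + 1) * ((szComp s.card (shiftProd s) Q.derivative).derivative.eval x * W) by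
    calc U ^ 2 ≤ U ^ 2 + _ := le_add_of_nonneg_right h
      _ = _ := by linear_combination -U * h1
  rcases Nat.eq_zero_or_pos s.card with h0 | h0
  · rw [Multiset.card_eq_zero] at h0
    subst h0
    simp [szComp]
  obtain ⟨m, hm⟩ := Nat.exists_eq_succ_of_ne_zero h0.ne'
  have h2 := congr_arg (eval x) (succ_mul_derivative_szComp m (shiftProd s) Q.derivative)
  have hm' : s.card = m + 1 := hm
  have hm0 : (0 : ℝ) < (m : ℝ) + 1 := by positivity
  rw [hm'] at hU hW h1 ⊢
  simp only [eval_mul, eval_C] at h2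
  refine (mul_nonneg_iff_of_pos_left hm0).1 ?_
  have h3 : ∀ (k : ℕ) (F G : ℝ[X]), eval x (szComp k (F * derivative (shiftProd s)) G) =
      (s.map fun b => eval x (szComp k (F * shiftProd (s.erase b)) G)).sum := by
    intro k F G
    rw [derivative_shiftProd, ← Multiset.sum_map_mul_left, sum_szComp, ← coe_evalRingHom,
      map_multiset_sum, Multiset.map_map, Multiset.map_map]
    rfl
  have h4 := h3 m 1 Q.derivative.derivative
  simp only [one_mul] at h4
  rw [mul_sub, h3]
  push_cast
  rw [show ((m : ℝ) + 1) * (((m : ℝ) + 1 + 1) * (eval x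
    (szComp (m + 1) (shiftProd s) Q.derivative).derivative * W)) = (((m : ℝ) + 1) * eval x
    (szComp (m + 1) (shiftProd s) Q.derivative).derivative) * (((m : ℝ) + 2) * W) by ring, h2, h4,
    mul_comm _ U, ← mul_assoc, ← Multiset.sum_map_mul_left, ← Multiset.sum_map_mul_right,
    ← Multiset.sum_map_sub]
  refine Multiset.sum_nonneg ?_
  intro y hy
  obtain ⟨b, hb, rfl⟩ := Multiset.mem_map.1 hy
  obtain ⟨R, rfl⟩ := Multiset.exists_cons_of_mem hb
  have hmR : m = R.card := by rw [Multiset.card_cons] at hm'; omega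
  subst hmR
  have := mul_eval_szComp_mul_le ha (hs b hb) R (fun c hc => (hs c (by simp [hc])).ne') hQ
    (by rwa [hm'] at hN) x
  rw [show R.card + 2 = R.card + 1 + 1 from rfl, ← hW, ← hU] at this
  rw [Multiset.erase_cons_head, ← shiftProd_cons, sub_nonneg]
  linarith

theorem Multiset.count_add_count_le_card {α : Type*} [DecidableEq α] {a b : α} (h : a ≠ b)
    (s : Multiset α) : s.count a + s.count b ≤ s.card := by
  have h1 := congr_arg Multiset.card (Multiset.filter_add_not (· = a) s)
  rw [Multiset.card_add] at h1
  have h2 : (s.filter (· = a)).card = s.count a := by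
    rw [Multiset.count_eq_card_filter_eq]
    simp only [eq_comm]
  have h3 : s.count b = (s.filter fun c => ¬ c = a).count b :=
    (Multiset.count_filter_of_pos (p := fun c => ¬ c = a) h.symm).symm
  have h4 := Multiset.count_le_card b (s.filter fun c => ¬ c = a)
  omega

/-- At a double root the Wronskian vanishes, hence so does its lower bound, a square. The recursion
then makes both polarizations with one argument missing vanish, for every removed factor `c`. -/
theorem exists_le_count_of_double_root (s : Multiset ℝ) (hs : ∀ a ∈ s, 0 < a) {Q : ℝ[X]}
    (hQ : IsHypNeg s.card Q) {x : ℝ} (hx : x ≠ 0)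
    (h0 : (szComp s.card (shiftProd s) Q).eval x = 0)
    (h1 : (szComp s.card (shiftProd s) Q).derivative.eval x = 0) :
    ∃ a b : ℝ, a * b = x ∧ s.card + 2 ≤ s.count a + Q.rootMultiplicity b := by
  have key : ∀ c ∈ s, ∃ a b : ℝ, a * b = x ∧
      s.card + 1 ≤ (s.erase c).count a + Q.rootMultiplicity b := by
    intro c hc
    obtain ⟨t, rfl⟩ := Multiset.exists_cons_of_mem hc
    rw [Multiset.erase_cons_head]
    rw [Multiset.card_cons] at *
    have hc0 := hs c hc
    have ht : ∀ a ∈ t, 0 < a := fun a ha => hs a (by simp [ha])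
    have hU := sq_le_wronskian hc0 t ht hQ.splits hQ.natDegree_eq.le x
    rw [h0, h1, zero_mul, mul_zero, sub_zero, mul_zero] at hU
    have hU0 := pow_eq_zero_iff two_ne_zero |>.1 (le_antisymm hU (sq_nonneg _))
    have hV := congr_arg (eval x)
      (succ_mul_szComp_X_add_C_mul (natDegree_shiftProd t).le c Q)
    rw [← shiftProd_cons] at hV
    simp only [eval_mul, eval_add, eval_C, eval_X, h0, hU0, mul_zero, zero_add] at hV
    obtain ⟨a, b, hab, hle⟩ := exists_le_count_add_rootMultiplicity t (fun a ha => (ht a ha).ne')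
      hQ.splits hQ.ne_zero hQ.natDegree_eq.le hx hU0
      ((mul_eq_zero.1 hV.symm).resolve_left hc0.ne')
    exact ⟨a, b, hab, by omega⟩
  have hW := IsHypNeg.szComp_shiftProd hs rfl hQ
  obtain ⟨c, hc⟩ : ∃ c, c ∈ s := by
    refine Multiset.card_pos_iff_exists_mem.1 (Nat.pos_of_ne_zero fun hc => ?_)
    have h2 := hW.rootMultiplicity_le x
    have h3 := (rootMultiplicity_pos hW.ne_zero).2 h0
    omega
  obtain ⟨a, b, hab, hle⟩ := key c hc
  have hbn := hQ.rootMultiplicity_le b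
  have hle' := Multiset.count_le_of_le a (Multiset.erase_le c s)
  have has : a ∈ s := Multiset.count_pos.1 (by omega)
  -- Removing an arbitrary `c` loses one in the bound. Removing `a` itself recovers it if the same
  -- `a` is found again; a different `a'` would come with `b' ≠ b`, and the multiplicities would
  -- exceed the two degrees.
  obtain ⟨a', b', hab', hle2⟩ := key a has
  have ha0 := (hs a has).ne'
  by_cases haa : a' = a
  · subst haa
    have hbb : b' = b := mul_left_cancel₀ ha0 (hab'.trans hab.symm)
    subst hbb
    rw [Multiset.count_erase_self] at hle2
    exact ⟨a', b', hab, by have := Multiset.count_pos.2 has; omega⟩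
  · exfalso
    have hbb : b ≠ b' := by
      rintro rfl
      have hb0 : b ≠ 0 := by rintro rfl; simp at hab; exact hx hab.symm
      exact haa (mul_right_cancel₀ hb0 (hab'.trans hab.symm))
    have h2 := Multiset.count_add_count_le_card hbb Q.roots
    rw [count_roots, count_roots, hQ.card_roots] at h2
    have h3 := Multiset.count_add_count_le_card (Ne.symm haa) s
    have h4 := Multiset.count_le_of_le a' (Multiset.erase_le a s)
    omega

namespace IsHypNeg

variable {n : ℕ} {P Q : ℝ[X]}

/-- A multiple root of `P'` must be a root of `P`; otherwise the sum of the positive numbers `1 / (a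
- r) ^ 2` would vanish. -/
theorem rootMultiplicity_derivative_of_two_le (hP : IsHypNeg n P) {a : ℝ}
    (h : 2 ≤ P.derivative.rootMultiplicity a) :
    P.derivative.rootMultiplicity a + 1 = P.rootMultiplicity a := by
  have hd0 : P.derivative ≠ 0 := by
    intro h0
    rw [h0, rootMultiplicity_zero] at h
    omega
  have hroot : P.IsRoot a := by
    by_contra ha
    obtain ⟨h1, h2⟩ := (one_lt_rootMultiplicity_iff_isRoot hd0).1 h
    have h3 := eval_derivative_sq_sub hP.splits ha
    rw [h1, h2, zero_pow two_ne_zero, mul_zero, sub_zero, zero_eq_mul] at h3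
    have h4 := h3.resolve_left (pow_ne_zero 2 ha)
    rw [Multiset.map_map] at h4
    have hne : P.roots ≠ ∅ := by
      intro h5
      have := hP.splits.natDegree_eq_card_roots
      rw [h5] at this
      exact hd0 (derivative_of_natDegree_zero this)
    have h6 := Multiset.sum_lt_sum_of_nonempty (f := fun _ => (0 : ℝ))
      (g := (fun e => ‖e‖ ^ 2) ∘ fun r => 1 / (a - r)) hne (fun r hr => by
        have : a - r ≠ 0 := by
          intro h7
          rw [sub_eq_zero.1 h7] at ha
          exact ha (isRoot_of_mem_roots hr)
        have := one_div_ne_zero this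
        simp only [Function.comp_apply]
        positivity)
    rw [h4] at h6
    simp at h6
  have h1 := derivative_rootMultiplicity_of_root hroot
  have h2 := (rootMultiplicity_pos hP.ne_zero).2 hroot
  omega

/-- Every multiple root of the composition is, up to sign, a product of roots. -/
theorem exists_rootMultiplicity_add_eq (hP : IsHypNeg n P) (hQ : IsHypNeg n Q) {x : ℝ}
    (h : 2 ≤ (_root_.szComp n P Q).rootMultiplicity x) :
    ∃ a b : ℝ, -(a * b) = x ∧ P.rootMultiplicity a + Q.rootMultiplicity b =
      n + (_root_.szComp n P Q).rootMultiplicity x := by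
  suffices H : ∃ a b : ℝ, -(a * b) = x ∧ n + (_root_.szComp n P Q).rootMultiplicity x ≤
      P.rootMultiplicity a + Q.rootMultiplicity b by
    obtain ⟨a, b, rfl, hle⟩ := H
    exact ⟨a, b, rfl, le_antisymm (rootMultiplicity_add_le hP hQ a b) hle⟩
  induction n generalizing P Q with
  | zero =>
    have := (hP.szComp hQ).rootMultiplicity_le x
    omega
  | succ n ih =>
    have hW := hP.szComp hQ
    have hroot : (_root_.szComp (n + 1) P Q).IsRoot x :=
      (rootMultiplicity_pos hW.ne_zero).1 (by omega)
    -- Multiplicity exactly 2 is the double-root lemma; a higher multiplicity descends to the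
    -- derivatives, where it is still at least 2.
    rcases h.eq_or_lt with h2 | h2
    · classical
      rw [← h2]
      obtain ⟨h0, h1⟩ := (one_lt_rootMultiplicity_iff_isRoot hW.ne_zero).1 h
      have hx : x ≠ 0 := (hW.2 x hroot).ne
      obtain ⟨c, s, hc, hn, hs, rfl⟩ := hP.exists_eq_C_mul_shiftProd
      rw [← hn] at hQ h0 h1 ⊢
      rw [C_mul_szComp] at h0 h1
      rw [derivative_C_mul] at h1
      simp only [IsRoot.def, eval_mul, eval_C, mul_eq_zero, hc, false_or] at h0 h1
      obtain ⟨a, b, hab, hle⟩ := exists_le_count_of_double_root s hs hQ hx h0 h1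
      refine ⟨-a, b, by rw [← hab]; ring, ?_⟩
      rwa [← count_roots, roots_C_mul _ hc, count_roots, rootMultiplicity_shiftProd]
    · have h3 := derivative_rootMultiplicity_of_root hroot
      rw [rootMultiplicity_derivative_szComp] at h3
      obtain ⟨a, b, hab, hle⟩ := ih hP.derivative hQ.derivative (by omega)
      have h4 := hP.derivative.rootMultiplicity_le a
      have h5 := hQ.derivative.rootMultiplicity_le b
      have h6 := hP.rootMultiplicity_derivative_of_two_le (a := a) (by omega)
      have h7 := hQ.rootMultiplicity_derivative_of_two_le (a := b) (by omega)
      exact ⟨a, b, hab, by omega⟩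

end IsHypNeg

/-! ### Interlacing and the count of the roots on one side of a product -/

theorem eval_nonneg_of_mul_sq {d F : ℝ[X]} (hd : d ≠ 0)
    (h : ∀ x, 0 ≤ d.eval x ^ 2 * F.eval x) (x : ℝ) : 0 ≤ F.eval x := by
  have hfin : {x | d.IsRoot x}.Finite := finite_setOfPred_isRoot hd
  have hdense : Dense ({x | d.IsRoot x}ᶜ : Set ℝ) := hfin.countable.dense_compl ℝ
  have hclosed : IsClosed {x | 0 ≤ F.eval x} := isClosed_le continuous_const F.continuous
  have hsub : ({x | d.IsRoot x}ᶜ : Set ℝ) ⊆ {x | 0 ≤ F.eval x} := fun y hy =>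
    (mul_nonneg_iff_of_pos_left (sq_pos_of_ne_zero hy)).1 (h y)
  exact hclosed.closure_subset_iff.2 hsub (hdense x)

theorem exists_isRoot_of_mul_neg {F : ℝ[X]} {x y : ℝ} (hxy : x < y)
    (h : F.eval x * F.eval y < 0) : ∃ z, x < z ∧ z < y ∧ F.IsRoot z := by
  rcases mul_neg_iff.1 h with ⟨h1, h2⟩ | ⟨h1, h2⟩
  · obtain ⟨z, hz, h⟩ := intermediate_value_Ioo' hxy.le F.continuousOn ⟨h2, h1⟩
    exact ⟨z, hz.1, hz.2, h⟩
  · obtain ⟨z, hz, h⟩ := intermediate_value_Ioo hxy.le F.continuousOn ⟨h1, h2⟩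
    exact ⟨z, hz.1, hz.2, h⟩

/-- The derivative of `W` has opposite signs at two consecutive simple roots, and `U` shares its
sign at both. -/
theorem exists_isRoot_between {W U : ℝ[X]} {x y : ℝ} (hxy : x < y) (hx : W.IsRoot x)
    (hy : W.IsRoot y) (hWx : 0 < W.derivative.eval x * U.eval x)
    (hWy : 0 < W.derivative.eval y * U.eval y) (hno : ∀ z, x < z → z < y → ¬ W.IsRoot z) :
    ∃ z, x < z ∧ z < y ∧ U.IsRoot z := by
  refine exists_isRoot_of_mul_neg hxy ?_
  obtain ⟨G, hG⟩ := dvd_iff_isRoot.2 hx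
  have hGy : G.IsRoot y := by
    have := hy
    rw [hG, IsRoot.def, eval_mul] at this
    exact (mul_eq_zero.1 this).resolve_left (by simpa using sub_ne_zero.2 hxy.ne')
  obtain ⟨H, hH⟩ := dvd_iff_isRoot.2 hGy
  have e : W = (X - C x) * ((X - C y) * H) := by rw [hG, hH]
  have ex : W.derivative.eval x = (x - y) * H.eval x := by rw [e]; simp
  have ey : W.derivative.eval y = (y - x) * H.eval y := by rw [e]; simp
  rw [ex] at hWx
  rw [ey] at hWy
  have hHH : 0 ≤ H.eval x * H.eval y := by
    by_contra hneg
    obtain ⟨z, h1, h2, h3⟩ := exists_isRoot_of_mul_neg hxy (not_le.1 hneg)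
    refine hno z h1 h2 ?_
    rw [e, IsRoot.def, eval_mul, eval_mul, h3, mul_zero, mul_zero]
  have h4 := mul_pos hWx hWy
  have h5 : (x - y) * eval x H * eval x U * ((y - x) * eval y H * eval y U) =
    -((y - x) ^ 2 * (H.eval x * H.eval y)) * (U.eval x * U.eval y) := by ring
  rw [h5] at h4
  by_contra hU
  have : 0 ≤ (y - x) ^ 2 * (H.eval x * H.eval y) := mul_nonneg (sq_nonneg _) hHH
  nlinarith [mul_nonneg this (not_lt.1 hU)]

/-- After division by the gcd, `hm` makes the roots of the first quotient simple and the Wronskian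
is positive at each of them, so the second quotient has a root between any two consecutive ones. The
roots of the gcd count equally on both sides. -/
theorem card_filter_roots_le_of_wronskian {W U : ℝ[X]} (hW : W ≠ 0) (hU : U ≠ 0)
    (hwr : ∀ x, 0 ≤ W.derivative.eval x * U.eval x - U.derivative.eval x * W.eval x)
    (hm : ∀ r, W.rootMultiplicity r ≤ U.rootMultiplicity r + 1) (S : Set ℝ)
    (hS : S.OrdConnected) [DecidablePred (· ∈ S)] :
    (W.roots.filter (· ∈ S)).card ≤ (U.roots.filter (· ∈ S)).card + 1 := by
  classical
  set d := EuclideanDomain.gcd W U with hd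
  obtain ⟨W₁, hW₁⟩ := EuclideanDomain.gcd_dvd_left W U
  obtain ⟨U₁, hU₁⟩ := EuclideanDomain.gcd_dvd_right W U
  rw [← hd] at hW₁ hU₁
  have hd0 : d ≠ 0 := by intro h; rw [h, zero_mul] at hW₁; exact hW hW₁
  have hW10 : W₁ ≠ 0 := by rintro rfl; rw [mul_zero] at hW₁; exact hW hW₁
  have hU10 : U₁ ≠ 0 := by rintro rfl; rw [mul_zero] at hU₁; exact hU hU₁
  have hcop : ∀ r, W₁.IsRoot r → U₁.eval r ≠ 0 := by
    intro r h1 h2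
    have h3 := EuclideanDomain.gcd_eq_gcd_ab W U
    rw [← hd] at h3
    set p := EuclideanDomain.gcdA W U
    set q := EuclideanDomain.gcdB W U
    rw [hW₁, hU₁] at h3
    have h4 : 1 = W₁ * p + U₁ * q := by
      refine mul_left_cancel₀ hd0 ?_
      linear_combination h3
    have h5 := congr_arg (eval r) h4
    simp [h1.eq_zero, h2] at h5
  have hsimple : ∀ r, W₁.IsRoot r → W₁.derivative.eval r ≠ 0 := by
    intro r h1 h2
    have h3 := (one_lt_rootMultiplicity_iff_isRoot hW10).2 ⟨h1, h2⟩
    have h4 := hm r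
    rw [hW₁, hU₁, rootMultiplicity_mul (hW₁ ▸ hW), rootMultiplicity_mul (hU₁ ▸ hU),
      rootMultiplicity_eq_zero (hcop r h1)] at h4
    omega
  have hwr₁ : ∀ x, 0 ≤ (W₁.derivative * U₁ - U₁.derivative * W₁).eval x := by
    refine eval_nonneg_of_mul_sq hd0 fun x => ?_
    have := hwr x
    rw [hW₁, hU₁] at this
    simp only [derivative_mul, eval_add, eval_mul, eval_sub] at this ⊢
    linarith
  have hpos : ∀ r, W₁.IsRoot r → 0 < W₁.derivative.eval r * U₁.eval r := by
    intro r hr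
    have := hwr₁ r
    rw [eval_sub, eval_mul, eval_mul, hr.eq_zero, mul_zero, sub_zero] at this
    exact lt_of_le_of_ne this (mul_ne_zero (hsimple r hr) (hcop r hr)).symm
  have hnodup : W₁.roots.Nodup := by
    refine Multiset.nodup_iff_count_le_one.2 fun r => ?_
    rw [count_roots]
    by_contra hlt
    obtain ⟨h1, h2⟩ := (one_lt_rootMultiplicity_iff_isRoot hW10).1 (not_le.1 hlt)
    exact hsimple r h1 h2
  have hmain : (W₁.roots.filter (· ∈ S)).toFinset.card ≤
      (U₁.roots.filter (· ∈ S)).toFinset.card + 1 := by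
    refine Finset.card_le_of_interleaved fun x hx y hy hxy hno => ?_
    simp only [Multiset.mem_toFinset, Multiset.mem_filter, mem_roots hW10, mem_roots hU10]
      at hx hy hno ⊢
    obtain ⟨z, h1, h2, h3⟩ := exists_isRoot_between hxy hx.1 hy.1 (hpos x hx.1) (hpos y hy.1)
      (fun z h1 h2 h3 => hno z ⟨h3, hS.out hx.2 hy.2 ⟨h1.le, h2.le⟩⟩ ⟨h1, h2⟩)
    exact ⟨z, ⟨h3, hS.out hx.2 hy.2 ⟨h1.le, h2.le⟩⟩, h1, h2⟩
  rw [Multiset.toFinset_card_of_nodup (hnodup.filter _)] at hmain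
  have h1 := Multiset.toFinset_card_le (U₁.roots.filter (· ∈ S))
  have h2 : W.roots = d.roots + W₁.roots := by rw [hW₁, roots_mul (hW₁ ▸ hW)]
  have h3 : U.roots = d.roots + U₁.roots := by rw [hU₁, roots_mul (hU₁ ▸ hU)]
  rw [h2, h3, Multiset.filter_add, Multiset.filter_add, Multiset.card_add, Multiset.card_add]
  omega

namespace IsHypNeg

variable {n : ℕ} {P Q : ℝ[X]}

theorem card_filter_roots_szComp_le {r : ℝ} (hP : IsHypNeg n P) (hr : r < 0)
    (hQ : IsHypNeg (n + 1) Q) (S : Set ℝ) (hS : S.OrdConnected) [DecidablePred (· ∈ S)] :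
    ((_root_.szComp (n + 1) ((X - C r) * P) Q).roots.filter (· ∈ S)).card ≤
      ((_root_.szComp n P Q.derivative).roots.filter (· ∈ S)).card + 1 := by
  have hP' : IsHypNeg (n + 1) ((X - C r) * P) := by
    refine of_natDegree (mul_ne_zero (X_sub_C_ne_zero r) hP.ne_zero) ?_
      ((Splits.X_sub_C r).mul hP.splits) ?_
    · rw [natDegree_mul (X_sub_C_ne_zero r) hP.ne_zero, natDegree_X_sub_C, hP.natDegree_eq,
        add_comm]
    · rw [roots_mul (mul_ne_zero (X_sub_C_ne_zero r) hP.ne_zero), roots_X_sub_C]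
      intro z hz
      rcases Multiset.mem_add.1 hz with h | h
      · rwa [Multiset.mem_singleton.1 h]
      · exact hP.neg_of_mem_roots h
  have hW := hP'.szComp hQ
  have hU := hP.szComp hQ.derivative
  refine card_filter_roots_le_of_wronskian hW.ne_zero hU.ne_zero ?_ ?_ S hS
  · intro x
    obtain ⟨c, s, hc, hn, hs, rfl⟩ := hP.exists_eq_C_mul_shiftProd
    subst hn
    have key := sq_le_wronskian (neg_pos.2 hr) s hs hQ.splits hQ.natDegree_eq.le x
    rw [shiftProd_cons] at key
    have e : (X - C r) * (C c * _root_.shiftProd s) =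
        C c * ((X + C (-r)) * _root_.shiftProd s) := by
      rw [C_neg]; ring
    have h1 := nonneg_of_mul_nonneg_right ((sq_nonneg _).trans key) (by positivity)
    simp only [e, C_mul_szComp, derivative_C_mul, eval_mul, eval_C]
    have := mul_nonneg (sq_nonneg c) h1
    linarith
  · intro x
    rcases lt_or_ge ((_root_.szComp (n + 1) ((X - C r) * P) Q).rootMultiplicity x) 2 with h | h
    · omega
    -- A multiple root comes from roots `a`, `b`; removing one factor and differentiating `Q` lowers
    -- the two multiplicities by at most 2 in all and the formal degree by 1.
    · obtain ⟨a, b, rfl, hab⟩ := exists_rootMultiplicity_add_eq hP' hQ h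
      have h1 := rootMultiplicity_add_le hP hQ.derivative a b
      have h2 := rootMultiplicity_sub_one_le_derivative_rootMultiplicity Q b
      have h3 : ((X - C r) * P).rootMultiplicity a ≤ 1 + P.rootMultiplicity a := by
        classical
        rw [rootMultiplicity_mul hP'.ne_zero, rootMultiplicity_X_sub_C]
        split_ifs <;> omega
      omega

end IsHypNeg

/-! ### Root counts on one side of a point -/

open Classical in
/-- The number of roots `r` of `P`, with multiplicity, such that `σ * (a - r)` is positive. -/
noncomputable def sideCount (σ a : ℝ) (P : ℝ[X]) : ℕ :=
  (P.roots.filter (· ∈ {r : ℝ | 0 < σ * (a - r)})).card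

theorem ordConnected_setOf_lt_mul_sub (σ a : ℝ) : {r : ℝ | 0 < σ * (a - r)}.OrdConnected := by
  refine ⟨fun x hx y hy z hz => ?_⟩
  simp only [Set.mem_ofPred_eq] at *
  rcases le_total 0 σ with h | h <;> nlinarith [hz.1, hz.2]

theorem ordConnected_setOf_mul_sub_le (σ a : ℝ) : {r : ℝ | σ * (a - r) ≤ 0}.OrdConnected := by
  refine ⟨fun x hx y hy z hz => ?_⟩
  simp only [Set.mem_ofPred_eq] at *
  rcases le_total 0 σ with h | h <;> nlinarith [hz.1, hz.2]

theorem sideCount_eq_zero {σ a : ℝ} {P : ℝ[X]} :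
    sideCount σ a P = 0 ↔ ∀ r ∈ P.roots, σ * (a - r) ≤ 0 := by
  classical
  rw [sideCount, Multiset.card_eq_zero, Multiset.filter_eq_nil]
  simp

theorem sideCount_X_sub_C_mul {σ a r : ℝ} {P : ℝ[X]} (hP : P ≠ 0) (h : 0 < σ * (a - r)) :
    sideCount σ a ((X - C r) * P) = sideCount σ a P + 1 := by
  classical
  rw [sideCount, sideCount, roots_mul (mul_ne_zero (X_sub_C_ne_zero r) hP), roots_X_sub_C,
    Multiset.filter_add, Multiset.card_add, Multiset.filter_singleton, add_comm]
  simp [h]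

namespace IsHypNeg

variable {n : ℕ} {P Q : ℝ[X]}

/-- `(X + 1) ^ n` is the identity for the composition, so the interlacing bound compares `P` with
its derivative. It is applied to the complementary half-line and subtracted from the totals `n + 1`
and `n`. -/
theorem sideCount_derivative_le (hP : IsHypNeg (n + 1) P) (σ a : ℝ) :
    sideCount σ a P.derivative ≤ sideCount σ a P := by
  classical
  have h1 : IsHypNeg n ((X + 1) ^ n : ℝ[X]) := by
    have := IsHypNeg.shiftProd (s := Multiset.replicate n 1) (n := n)
      (fun a ha => by rw [Multiset.eq_of_mem_replicate ha]; norm_num) (by simp)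
    simpa [_root_.shiftProd] using this
  have h2 := card_filter_roots_szComp_le h1 (r := -1) (by norm_num) hP
    {r | σ * (a - r) ≤ 0} (ordConnected_setOf_mul_sub_le σ a)
  have h3 : ((X - C (-1)) * (X + 1) ^ n : ℝ[X]) = (X + 1) ^ (n + 1) := by
    rw [pow_succ', C_neg, C_1, sub_neg_eq_add]
  rw [h3, szComp_X_add_one_pow hP.natDegree_eq.le,
    szComp_X_add_one_pow hP.derivative.natDegree_eq.le] at h2
  have key : ∀ F : ℝ[X], (F.roots.filter (· ∈ {r | σ * (a - r) ≤ 0})).card + sideCount σ a F =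
      F.roots.card := by
    intro F
    rw [sideCount, ← Multiset.card_add]
    refine congr_arg Multiset.card ?_
    convert Multiset.filter_add_not (· ∈ {r | σ * (a - r) ≤ 0}) F.roots using 3
    simp
  have h4 := key P
  have h5 := key P.derivative
  rw [hP.card_roots] at h4
  rw [hP.derivative.card_roots] at h5
  omega

theorem sideCount_szComp_X_sub_C_mul_le {r : ℝ} (hP : IsHypNeg n P) (hr : r < 0)
    (hQ : IsHypNeg (n + 1) Q) (σ a : ℝ) :
    sideCount σ a (_root_.szComp (n + 1) ((X - C r) * P) Q) ≤
      sideCount σ a (_root_.szComp n P Q.derivative) + 1 := by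
  classical
  exact card_filter_roots_szComp_le hP hr hQ _ (ordConnected_setOf_lt_mul_sub σ a)

theorem exists_eq_X_sub_C_mul (hP : IsHypNeg (n + 1) P) {r : ℝ} (hr : P.IsRoot r) :
    ∃ R, P = (X - C r) * R ∧ IsHypNeg n R := by
  obtain ⟨R, rfl⟩ := dvd_iff_isRoot.2 hr
  have hR : R ≠ 0 := by
    rintro rfl
    simpa using hP.ne_zero
  refine ⟨R, rfl, of_natDegree hR ?_ (hP.splits.of_dvd hP.ne_zero (dvd_mul_left _ _)) ?_⟩
  · have := hP.natDegree_eq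
    rw [natDegree_mul (X_sub_C_ne_zero r) hR, natDegree_X_sub_C] at this
    omega
  · intro z hz
    exact hP.neg_of_mem_roots ((mem_roots hP.ne_zero).2
      (by rw [IsRoot.def, eval_mul, isRoot_of_mem_roots hz, mul_zero]))

/-- The half-plane theorem with `u = σ` and `c = σ * b`: for `x` on the given side of `-(a * b)`,
all poles `x / y` lie strictly beyond `b`, where `Q` has no roots. -/
theorem sideCount_szComp_eq_zero (hP : IsHypNeg n P) (hQ : IsHypNeg n Q) {σ a b : ℝ}
    (hb : b < 0) (h1 : sideCount σ a P = 0) (h2 : sideCount σ b Q = 0) :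
    sideCount σ (-(a * b)) (_root_.szComp n P Q) = 0 := by
  rw [sideCount_eq_zero] at *
  obtain ⟨c, s, hc, hn, hs, rfl⟩ := hP.exists_eq_C_mul_shiftProd
  subst hn
  rw [roots_C_mul _ hc, roots_shiftProd] at h1
  intro x hx
  by_contra! hlt
  rw [C_mul_szComp, roots_C_mul _ hc] at hx
  refine eval_map_szComp_shiftProd_ne_zero (u := σ) (x := x) (c := σ * b) s ?_ hQ.ne_zero
    hQ.natDegree_eq hQ.splits ?_ ?_
  · intro y hy
    have hy0 := hs y hy
    have h3 := h1 (-y) (Multiset.mem_map_of_mem _ hy)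
    refine ⟨hy0.ne', ?_⟩
    rw [← Complex.ofReal_div, ← Complex.ofReal_mul, Complex.ofReal_re, ← mul_div_assoc,
      div_lt_iff₀ hy0]
    nlinarith
  · intro r hr
    rw [← Complex.ofReal_mul, Complex.ofReal_re]
    have := h2 r hr
    linarith
  · rw [← Complex.ofRealHom_eq_coe, eval_map_apply, isRoot_of_mem_roots hx, map_zero]

/-- As long as one of the two polynomials has a root on its side, that root is removed and the other
polynomial is differentiated. By interlacing the count for the composition drops by at most one. -/
theorem sideCount_szComp_le (hP : IsHypNeg n P) (hQ : IsHypNeg n Q) {σ a b : ℝ}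
    (ha : a < 0) (hb : b < 0) :
    sideCount σ (-(a * b)) (_root_.szComp n P Q) ≤ sideCount σ a P + sideCount σ b Q := by
  induction n generalizing P Q a b with
  | zero =>
    rw [sideCount_szComp_eq_zero hP hQ hb]
    · omega
    all_goals
      rw [sideCount_eq_zero]
      intro r hr
      have := Multiset.card_pos_iff_exists_mem.2 ⟨r, hr⟩
      first
      | (rw [hP.card_roots] at this; omega)
      | (rw [hQ.card_roots] at this; omega)
  | succ n ih =>
    classical
    have step : ∀ {F G : ℝ[X]} {e f : ℝ}, IsHypNeg (n + 1) F → IsHypNeg (n + 1) G → e < 0 →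
        f < 0 → sideCount σ e F ≠ 0 → sideCount σ (-(e * f)) (_root_.szComp (n + 1) F G) ≤
          sideCount σ e F + sideCount σ f G := by
      intro F G e f hF hG he hf h0
      rw [Ne, sideCount_eq_zero] at h0
      push Not at h0
      obtain ⟨r, hr, hlt⟩ := h0
      have hr0 := hF.neg_of_mem_roots hr
      obtain ⟨R, rfl, hR⟩ := hF.exists_eq_X_sub_C_mul (isRoot_of_mem_roots hr)
      rw [sideCount_X_sub_C_mul hR.ne_zero hlt]
      have h1 := sideCount_szComp_X_sub_C_mul_le hR hr0 hG σ (-(e * f))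
      have h2 := ih hR hG.derivative he hf
      have h3 := hG.sideCount_derivative_le σ f
      omega
    by_cases h1 : sideCount σ a P = 0
    · by_cases h2 : sideCount σ b Q = 0
      · rw [sideCount_szComp_eq_zero hP hQ hb h1 h2]
        omega
      · rw [szComp_comm, mul_comm a, add_comm (sideCount σ a P)]
        exact step hQ hP hb ha h2
    · exact step hP hQ ha hb h1

end IsHypNeg

/-- The number of roots of `P` below `a`, with multiplicity. -/
noncomputable def rootsBelow (P : ℝ[X]) (a : ℝ) : ℕ := (P.roots.filter (· < a)).card

/-- The counts below, at and above `-(a * b)` are each bounded above. The three counts and the three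
bounds both total `n`, so every bound is attained. -/
theorem IsHypNeg.rootsBelow_szComp {n : ℕ} {P Q : ℝ[X]} (hP : IsHypNeg n P) (hQ : IsHypNeg n Q)
    {a b : ℝ} (ha : a < 0) (hb : b < 0)
    (h : n < P.rootMultiplicity a + Q.rootMultiplicity b) :
    (_root_.szComp n P Q).rootMultiplicity (-(a * b)) =
        P.rootMultiplicity a + Q.rootMultiplicity b - n ∧
      rootsBelow (_root_.szComp n P Q) (-(a * b)) = rootsBelow P a + rootsBelow Q b := by
  classical
  have hW := hP.szComp hQ
  have key : ∀ (F : ℝ[X]) (c : ℝ), sideCount 1 c F = rootsBelow F c ∧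
      sideCount 1 c F + F.rootMultiplicity c + sideCount (-1) c F = F.roots.card := by
    intro F c
    have e : sideCount 1 c F = rootsBelow F c := by
      refine congr_arg Multiset.card (Multiset.filter_congr fun r _ => ?_)
      simp
    refine ⟨e, ?_⟩
    have h1 := congr_arg Multiset.card (Multiset.filter_add_not (· < c) F.roots)
    have h2 := congr_arg Multiset.card
      (Multiset.filter_add_not (c = ·) (F.roots.filter (¬ · < c)))
    have h3 : ((F.roots.filter (¬ · < c)).filter (c = ·)).card = F.rootMultiplicity c := by
      rw [← count_roots, ← Multiset.count_eq_card_filter_eq,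
        Multiset.count_filter_of_pos (p := fun r => ¬ r < c) (lt_irrefl c)]
    have h4 : ((F.roots.filter (¬ · < c)).filter (¬ c = ·)).card = sideCount (-1) c F := by
      rw [Multiset.filter_filter]
      refine congr_arg Multiset.card (Multiset.filter_congr fun r _ => ?_)
      simp only [not_lt, Set.mem_ofPred_eq]
      constructor
      · rintro ⟨h5, h6⟩
        have := lt_of_le_of_ne h6 h5
        linarith
      · intro h5
        have : c < r := by linarith
        exact ⟨this.ne, this.le⟩
    rw [Multiset.card_add] at h1 h2
    rw [e, rootsBelow]
    omega
  obtain ⟨p1, p2⟩ := key P a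
  obtain ⟨q1, q2⟩ := key Q b
  obtain ⟨w1, w2⟩ := key (_root_.szComp n P Q) (-(a * b))
  rw [hP.card_roots] at p2
  rw [hQ.card_roots] at q2
  rw [hW.card_roots] at w2
  have i1 := hP.sideCount_szComp_le hQ (σ := 1) ha hb
  have i2 := hP.sideCount_szComp_le hQ (σ := -1) ha hb
  have hmul : (_root_.szComp n P Q).rootMultiplicity (-(a * b)) ≤
      P.rootMultiplicity a + Q.rootMultiplicity b - n := by
    rcases lt_or_ge ((_root_.szComp n P Q).rootMultiplicity (-(a * b))) 2 with h2 | h2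
    · omega
    · obtain ⟨a', b', hab, he⟩ := hP.exists_rootMultiplicity_add_eq hQ h2
      have c1 := fun h => Multiset.count_add_count_le_card (a := a) (b := a') h P.roots
      have c2 := fun h => Multiset.count_add_count_le_card (a := b) (b := b') h Q.roots
      simp only [count_roots, hP.card_roots, hQ.card_roots] at c1 c2
      by_cases haa : a = a'
      · have hbb : b = b' := by
          have := neg_injective hab
          rw [← haa] at this
          exact (mul_left_cancel₀ ha.ne this).symm
        rw [← haa, ← hbb] at he
        omega
      -- Two distinct pairs of roots, each with multiplicities adding up to more than `n`, cannot
      -- have the same product: they would differ in both entries and total more than `2 * n`.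
      · have hbb : b ≠ b' := by
          intro hbb
          have := neg_injective hab
          rw [← hbb] at this
          exact haa (mul_right_cancel₀ hb.ne this).symm
        have := c1 haa
        have := c2 hbb
        omega
  omega

/-! ### Multiplicity vectors and composed partitions -/

theorem sum_map_count_take {l : List ℝ} (hl : l.Pairwise (· < ·)) {s : Multiset ℝ}
    (hs : ∀ x, x ∈ l ↔ x ∈ s) {i : ℕ} (hi : i < l.length) :
    ((l.take i).map (fun x => s.count x)).sum = (s.filter (· < l[i])).card := by
  have hnd : l.Nodup := hl.imp fun h => h.ne
  rw [← List.sum_toFinset _ (hnd.sublist (List.take_sublist i l)),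
    ← Multiset.toFinset_sum_count_eq]
  refine Finset.sum_congr ?_ ?_
  · ext x
    simp only [List.mem_toFinset, Multiset.mem_toFinset, Multiset.mem_filter, ← hs]
    constructor
    · intro hx
      obtain ⟨j, hj, rfl⟩ := List.mem_take_iff_getElem.1 hx
      exact ⟨List.getElem_mem _, List.pairwise_iff_getElem.1 hl j i _ _ (by omega)⟩
    · rintro ⟨hx, hlt⟩
      obtain ⟨j, hj, rfl⟩ := List.mem_iff_getElem.1 hx
      refine List.mem_take_iff_getElem.2 ⟨j, ?_, rfl⟩
      rcases lt_trichotomy j i with h | h | h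
      · omega
      · subst h
        exact absurd hlt (lt_irrefl _)
      · exact absurd hlt (List.pairwise_iff_getElem.1 hl i j hi hj h).le.not_gt
  · intro x hx
    simp only [Multiset.mem_toFinset, Multiset.mem_filter] at hx
    exact (Multiset.count_filter_of_pos (p := (· < l[i])) hx.2).symm

section MultVector

variable {n : ℕ} {P : ℝ[X]} (hP : IsHyp n P)

theorem multVector_length :
    (multVector n P hP).length = (P.roots.toFinset.sort (· ≤ ·)).length := by
  simp [Composition.length, multVector, multList]

theorem blocksFun_multVector (i : Fin (multVector n P hP).length)
    (hi : (i : ℕ) < (P.roots.toFinset.sort (· ≤ ·)).length) :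
    (multVector n P hP).blocksFun i =
      P.rootMultiplicity ((P.roots.toFinset.sort (· ≤ ·))[(i : ℕ)]) :=
  List.getElem_map _

theorem sizeUpTo_multVector {i : ℕ} (hi : i < (P.roots.toFinset.sort (· ≤ ·)).length) :
    (multVector n P hP).sizeUpTo i =
      rootsBelow P ((P.roots.toFinset.sort (· ≤ ·))[i]) := by
  rw [rootsBelow, ← sum_map_count_take (Finset.sortedLT_sort _).pairwise (by simp) hi]
  simp [Composition.sizeUpTo, multVector, multList, count_roots, List.map_take]

theorem exists_root_multVector (i : Fin (multVector n P hP).length) :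
    ∃ r ∈ P.roots, (multVector n P hP).blocksFun i = P.rootMultiplicity r ∧
      (multVector n P hP).sizeUpTo i = rootsBelow P r := by
  have hi : (i : ℕ) < (P.roots.toFinset.sort (· ≤ ·)).length := by
    rw [← multVector_length hP]
    exact i.2
  refine ⟨_, ?_, blocksFun_multVector hP i hi, sizeUpTo_multVector hP hi⟩
  simpa using (Finset.mem_sort (· ≤ ·)).1 (List.getElem_mem hi)

theorem exists_index_multVector {r : ℝ} (hr : r ∈ P.roots) :
    ∃ i : Fin (multVector n P hP).length,
      (multVector n P hP).blocksFun i = P.rootMultiplicity r ∧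
      (multVector n P hP).sizeUpTo i = rootsBelow P r := by
  obtain ⟨i, hi, rfl⟩ := List.mem_iff_getElem.1
    ((Finset.mem_sort (· ≤ ·)).2 (Multiset.mem_toFinset.2 hr))
  exact ⟨⟨i, by rwa [multVector_length hP]⟩, blocksFun_multVector hP _ hi,
    sizeUpTo_multVector hP hi⟩

end MultVector

/-- A block corresponds to a root, its size to the multiplicity and `sizeUpTo` to the number of
roots below. A block of size other than 1 is a multiple root, hence comes from an A-pair. -/
theorem isComposedPartition_multVector {n : ℕ} {P Q W : ℝ[X]} (hP : IsHypNeg n P)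
    (hQ : IsHypNeg n Q) (hW : IsHypNeg n W) (h : W = szComp n P Q) :
    IsComposedPartition (multVector n P hP.1) (multVector n Q hQ.1) (multVector n W hW.1) := by
  subst h
  constructor
  · intro i j hij
    obtain ⟨a, ha, ha1, ha2⟩ := exists_root_multVector hP.1 i
    obtain ⟨b, hb, hb1, hb2⟩ := exists_root_multVector hQ.1 j
    rw [IsAPair, ha1, hb1] at hij
    obtain ⟨h1, h2⟩ := hP.rootsBelow_szComp hQ (hP.neg_of_mem_roots ha)
      (hQ.neg_of_mem_roots hb) hij
    have hroot : -(a * b) ∈ (szComp n P Q).roots :=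
      (mem_roots hW.ne_zero).2 ((rootMultiplicity_pos hW.ne_zero).1 (by omega))
    obtain ⟨k, hk1, hk2⟩ := exists_index_multVector hW.1 hroot
    exact ⟨k, by rw [hk1, h1, ha1, hb1], by rw [hk2, h2, ha2, hb2]⟩
  · intro k hk
    obtain ⟨x, hx, hx1, hx2⟩ := exists_root_multVector hW.1 k
    have hpos := (rootMultiplicity_pos hW.ne_zero).2 (isRoot_of_mem_roots hx)
    rw [hx1]
    by_contra hne
    obtain ⟨a, b, rfl, hab⟩ := hP.exists_rootMultiplicity_add_eq hQ (x := x) (by omega)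
    have h1 := hP.rootMultiplicity_le a
    have h2 := hQ.rootMultiplicity_le b
    have ha : a ∈ P.roots :=
      (mem_roots hP.ne_zero).2 ((rootMultiplicity_pos hP.ne_zero).1 (by omega))
    have hb : b ∈ Q.roots :=
      (mem_roots hQ.ne_zero).2 ((rootMultiplicity_pos hQ.ne_zero).1 (by omega))
    obtain ⟨i, hi1, hi2⟩ := exists_index_multVector hP.1 ha
    obtain ⟨j, hj1, hj2⟩ := exists_index_multVector hQ.1 hb
    refine hk ⟨i, j, by rw [IsAPair, hi1, hj1]; omega, ?_⟩
    rw [hx2, hi2, hj2]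
    exact (hP.rootsBelow_szComp hQ (hP.neg_of_mem_roots ha)
      (hQ.neg_of_mem_roots hb) (by omega)).2

/-! ### Compositions determined by the blocks at their starting positions -/

namespace Composition

variable {n : ℕ}

theorem sizeUpTo_lt_of_lt (r : Composition n) {i j : ℕ} (hij : i < j) (hi : i < r.length) :
    r.sizeUpTo i < r.sizeUpTo j :=
  (r.sizeUpTo_strict_mono hi).trans_le (r.monotone_sizeUpTo hij)

theorem eq_of_sizeUpTo_eq (r : Composition n) {i j : Fin r.length}
    (h : r.sizeUpTo i = r.sizeUpTo j) : i = j := by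
  rcases lt_trichotomy (i : ℕ) j with hij | hij | hij
  · exact absurd h (r.sizeUpTo_lt_of_lt hij i.2).ne
  · exact Fin.ext hij
  · exact absurd h (r.sizeUpTo_lt_of_lt hij j.2).ne'

theorem length_le_iff_sizeUpTo (r : Composition n) (k : ℕ) :
    r.length ≤ k ↔ r.sizeUpTo k = n := by
  refine ⟨r.sizeUpTo_ofLength_le k, fun h => ?_⟩
  by_contra! hlt
  have := r.sizeUpTo_strict_mono hlt
  have := r.sizeUpTo_le (k + 1)
  omega

/-- A composition is determined by the size of the block that starts at each position. -/
theorem eq_of_blocksFun_eq {r r' : Composition n}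
    (h : ∀ (k : Fin r.length) (k' : Fin r'.length), r.sizeUpTo k = r'.sizeUpTo k' →
      r.blocksFun k = r'.blocksFun k') : r = r' := by
  have hsize : ∀ k : ℕ, r.sizeUpTo k = r'.sizeUpTo k := by
    intro k
    induction k with
    | zero => simp
    | succ k ih =>
      rcases lt_or_ge k r.length with hk | hk
      · have hk' : k < r'.length := by
          by_contra! hk'
          rw [length_le_iff_sizeUpTo, ← ih, ← length_le_iff_sizeUpTo] at hk'
          omega
        have h1 := r.sizeUpTo_succ' ⟨k, hk⟩
        have h2 := r'.sizeUpTo_succ' ⟨k, hk'⟩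
        have h3 := h ⟨k, hk⟩ ⟨k, hk'⟩ ih
        simp only at h1 h2
        rw [h1, h2, ih, h3]
      · have hk' := hk
        rw [length_le_iff_sizeUpTo, ih, ← length_le_iff_sizeUpTo] at hk'
        rw [r.sizeUpTo_ofLength_le _ (by omega), r'.sizeUpTo_ofLength_le _ (by omega)]
  have hlen : r.length = r'.length := by
    refine le_antisymm ?_ ?_
    · rw [length_le_iff_sizeUpTo, hsize, sizeUpTo_length]
    · rw [length_le_iff_sizeUpTo, ← hsize, sizeUpTo_length]
  refine Composition.ext (List.ext_getElem hlen fun k h1 h2 => ?_)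
  exact h ⟨k, h1⟩ ⟨k, h2⟩ (hsize k)

end Composition

theorem IsComposedPartition.eq {n : ℕ} {p q r r' : Composition n}
    (hr : IsComposedPartition p q r) (hr' : IsComposedPartition p q r') : r = r' := by
  refine Composition.eq_of_blocksFun_eq fun k k' hkk => ?_
  by_cases h : ∃ (i : Fin p.length) (j : Fin q.length), IsAPair p q i j ∧
      r.sizeUpTo k = p.sizeUpTo i + q.sizeUpTo j
  · obtain ⟨i, j, hij, hk⟩ := h
    obtain ⟨l, hl1, hl2⟩ := hr.1 i j hij
    obtain ⟨l', hl1', hl2'⟩ := hr'.1 i j hij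
    rw [r.eq_of_sizeUpTo_eq (hk.trans hl2.symm), hl1,
      r'.eq_of_sizeUpTo_eq ((hkk.symm.trans hk).trans hl2'.symm), hl1']
  · rw [hr.2 k h, hr'.2 k' (by rwa [← hkk])]

theorem exists_multVector_eq {n : ℕ} (p : Composition n) :
    ∃ (P : ℝ[X]) (hP : IsHypNeg n P), multVector n P hP.1 = p := by
  classical
  -- The distinct roots are chosen as `-p.length, …, -1`.
  let f : Fin p.length → ℝ := fun i => (i : ℝ) - p.length
  have hf : StrictMono f := fun i j h => by
    have : ((i : ℕ) : ℝ) < (j : ℕ) := by exact_mod_cast h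
    simp only [f]
    linarith
  let s : Multiset ℝ := ∑ i, Multiset.replicate (p.blocksFun i) (f i)
  have hmem : ∀ x, x ∈ s ↔ ∃ i, f i = x := by
    intro x
    simp only [s, Multiset.mem_sum, Finset.mem_univ, true_and, Multiset.mem_replicate]
    exact ⟨fun ⟨i, _, h⟩ => ⟨i, h.symm⟩,
      fun ⟨i, h⟩ => ⟨i, Nat.one_le_iff_ne_zero.1 (p.one_le_blocksFun i), h.symm⟩⟩
  have hcount : ∀ i, s.count (f i) = p.blocksFun i := by
    intro i
    simp only [s, Multiset.count_sum', Multiset.count_replicate, hf.injective.eq_iff]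
    simp
  have hcard : s.card = n := by
    simp only [s, Multiset.card_sum, Multiset.card_replicate]
    exact p.sum_blocksFun
  have hroots : (s.map fun a => X - C a).prod.roots = s := roots_multiset_prod_X_sub_C s
  refine ⟨(s.map fun a => X - C a).prod, .of_natDegree (monic_multisetProd_X_sub_C s).ne_zero
    ((natDegree_multiset_prod_X_sub_C_eq_card s).trans hcard) ?_ ?_, Composition.ext ?_⟩
  · refine Splits.multisetProd fun g hg => ?_
    obtain ⟨a, -, rfl⟩ := Multiset.mem_map.1 hg
    exact Splits.X_sub_C a
  · rw [hroots]
    intro r hr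
    obtain ⟨i, rfl⟩ := (hmem r).1 hr
    have : ((i : ℕ) : ℝ) < p.length := by exact_mod_cast i.2
    simp only [f]
    linarith
  · change multList _ = p.blocks
    have hsort : s.toFinset.sort (· ≤ ·) = List.ofFn f := by
      have h1 : s.toFinset = (List.ofFn f).toFinset := by
        ext x
        simp [hmem]
      rw [h1, List.toFinset_sort _ (List.nodup_ofFn.2 hf.injective)]
      exact List.pairwise_ofFn.2 fun i j h => (hf h).le
    rw [multList, hroots, hsort, List.map_ofFn, ← p.ofFn_blocksFun]
    congr 1
    ext i
    rw [Function.comp_apply, ← count_roots, hroots, hcount]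

/-! ### The induced semigroup structure -/

/-- The product on ordered partitions induced by the Schur–Szegő composition. -/
noncomputable def composedPartition {n : ℕ} (p q : Composition n) : Composition n :=
  multVector n _ ((exists_multVector_eq p).choose_spec.choose.szComp
    (exists_multVector_eq q).choose_spec.choose).1

theorem isComposedPartition_composedPartition {n : ℕ} (p q : Composition n) :
    IsComposedPartition p q (composedPartition p q) := by
  have h := isComposedPartition_multVector (exists_multVector_eq p).choose_spec.choose
    (exists_multVector_eq q).choose_spec.choose
    ((exists_multVector_eq p).choose_spec.choose.szComp
      (exists_multVector_eq q).choose_spec.choose) rfl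
  rw [(exists_multVector_eq p).choose_spec.choose_spec,
    (exists_multVector_eq q).choose_spec.choose_spec] at h
  exact h

/-- The product does not depend on the chosen polynomials, because the combinatorial rules have only
one solution. -/
theorem composedPartition_multVector {n : ℕ} {P Q W : ℝ[X]} (hP : IsHypNeg n P)
    (hQ : IsHypNeg n Q) (hW : IsHypNeg n W) (h : W = szComp n P Q) :
    composedPartition (multVector n P hP.1) (multVector n Q hQ.1) = multVector n W hW.1 :=
  (isComposedPartition_composedPartition _ _).eq (isComposedPartition_multVector hP hQ hW h)

theorem composedPartition_assoc {n : ℕ} (p q r : Composition n) :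
    composedPartition (composedPartition p q) r = composedPartition p (composedPartition q r) := by
  obtain ⟨P, hP, rfl⟩ := exists_multVector_eq p
  obtain ⟨Q, hQ, rfl⟩ := exists_multVector_eq q
  obtain ⟨R, hR, rfl⟩ := exists_multVector_eq r
  rw [composedPartition_multVector hP hQ (hP.szComp hQ) rfl,
    composedPartition_multVector hQ hR (hQ.szComp hR) rfl,
    composedPartition_multVector (hP.szComp hQ) hR ((hP.szComp hQ).szComp hR) rfl,
    composedPartition_multVector hP (hQ.szComp hR) ((hP.szComp hQ).szComp hR)
      (szComp_assoc n P Q R)]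

/-- The semigroup of ordered partitions of `n`. -/
@[reducible] noncomputable def compositionSemigroup (n : ℕ) : Semigroup (Composition n) where
  mul := composedPartition
  mul_assoc := composedPartition_assoc

theorem isInducedSemigroup_compositionSemigroup (n : ℕ) :
    IsInducedSemigroup n (compositionSemigroup n) := fun P Q hP hQ => by
  have hW : IsHypNeg n (schurSzego n P Q) := by
    rw [schurSzego_eq_szComp]
    exact hP.szComp hQ
  exact ⟨hW, (composedPartition_multVector hP hQ hW (schurSzego_eq_szComp n P Q)).symm⟩

theorem IsInducedSemigroup.eq {n : ℕ} {S S' : Semigroup (Composition n)}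
    (hS : IsInducedSemigroup n S) (hS' : IsInducedSemigroup n S') : S = S' := by
  have hmul : S.mul = S'.mul := by
    funext p q
    obtain ⟨P, hP, rfl⟩ := exists_multVector_eq p
    obtain ⟨Q, hQ, rfl⟩ := exists_multVector_eq q
    obtain ⟨_, h⟩ := hS P Q hP hQ
    obtain ⟨_, h'⟩ := hS' P Q hP hQ
    rw [← h, ← h']
  exact Semigroup.ext hmul

theorem IsInducedSemigroup.mul_eq_iff {n : ℕ} {S : Semigroup (Composition n)}
    (hS : IsInducedSemigroup n S) (p q r : Composition n) :
    S.mul p q = r ↔ IsComposedPartition p q r := by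
  rw [hS.eq (isInducedSemigroup_compositionSemigroup n)]
  have h := isComposedPartition_composedPartition p q
  exact ⟨fun e => e ▸ h, fun h' => h.eq h'⟩

instance {n : ℕ} (p q : Composition n) (i : Fin p.length) (j : Fin q.length) :
    Decidable (IsAPair p q i j) :=
  inferInstanceAs (Decidable (_ < _))

instance {n : ℕ} (p q r : Composition n) : Decidable (IsComposedPartition p q r) :=
  inferInstanceAs (Decidable (_ ∧ _))

theorem mainTheorem4 :
    (∀ n : ℕ,
      -- every ordered partition of `n` is the multiplicity vector of some element of `Hyp_n^-`
      (∀ p : Composition n, ∃ (P : ℝ[X]) (hP : IsHypNeg n P), multVector n P hP.1 = p) ∧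
      -- the induced semigroup structure exists, is unique, and is given by the rules
      ∃ S : Semigroup (Composition n),
        IsInducedSemigroup n S ∧
        (∀ S' : Semigroup (Composition n), IsInducedSemigroup n S' → S' = S) ∧
        (∀ p q r : Composition n, S.mul p q = r ↔ IsComposedPartition p q r)) ∧
    -- the two examples, with `n = 17`
    (∀ S : Semigroup (Composition 17), IsInducedSemigroup 17 S →
      (∀ p q : Composition 17, p.blocks = [2, 14, 1] → q.blocks = [5, 6, 6] →
        (S.mul p q).blocks = [1, 1, 2, 1, 1, 1, 3, 1, 1, 1, 3, 1]) ∧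
      (∀ p q : Composition 17, p.blocks = [1, 14, 2] → q.blocks = [5, 6, 4, 2] →
        (S.mul p q).blocks = [1, 2, 1, 1, 1, 3, 1, 1, 1, 1, 1, 1, 1, 1])) := by
  refine ⟨fun n => ⟨exists_multVector_eq, compositionSemigroup n,
    isInducedSemigroup_compositionSemigroup n,
    fun S' hS' => hS'.eq (isInducedSemigroup_compositionSemigroup n),
    (isInducedSemigroup_compositionSemigroup n).mul_eq_iff⟩, fun S hS => ⟨?_, ?_⟩⟩
  · intro p q hp hq
    obtain rfl : p = ⟨[2, 14, 1], by simp, rfl⟩ := Composition.ext hp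
    obtain rfl : q = ⟨[5, 6, 6], by simp, rfl⟩ := Composition.ext hq
    rw [(hS.mul_eq_iff _ _ ⟨[1, 1, 2, 1, 1, 1, 3, 1, 1, 1, 3, 1], by simp, rfl⟩).2 (by decide)]
  · intro p q hp hq
    obtain rfl : p = ⟨[1, 14, 2], by simp, rfl⟩ := Composition.ext hp
    obtain rfl : q = ⟨[5, 6, 4, 2], by simp, rfl⟩ := Composition.ext hq
    rw [(hS.mul_eq_iff _ _ ⟨[1, 2, 1, 1, 1, 3, 1, 1, 1, 1, 1, 1, 1, 1], by simp, rfl⟩).2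
      (by decide)]
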